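/- All manifolds and curves are smooth. Let $S$ be a closed connected orientable surface of genus $g$. **Diagrams.** A Johansson diagram $\mathcal D=\{\alpha_1,\dots,\alpha_{2k}\}$ on $S$ consists of immersed closed curves $\alpha_i:\mathbb R\to S$ of period $1$, which meet themselves and each other only at transverse crossings of exactly two branches, together with a fixed-point-free involution $\tau$ of the set of curves (sister curves), such that under the equivalence relation on $S$ generated by $\alpha(t)\sim(\tau\alpha)(t)$ ($\alpha\in\mathcal D$, $t\in\mathbb R$) every non-crossing point of the curves lies in a class of exactly two points and every crossing lies in a class of exactly three points (a triplet). The quotient space $\Sigma=S/{\sim}$ is the pseudo Dehn $g$-torus of $\mathcal D$. If $f:S\to M$ is an immersion in a closed connected orientable 3-manifold in general position (its only singularities are transverse double and triple points), then $\Sigma=f(S)\subset M$ is a Dehn $g$-torus, and $\mathcal D$ is its Johansson diagram if $f(y)=f(z)\Leftrightarrow y\sim z$ for all $y,z\in S$. In both cases let $f:S\to\Sigma$ denote the projection. A triple point of $\Sigma$ is the image of a triplet. **Choices.** Fix $x\in S$ on no curve of $\mathcal D$. Products of paths are concatenations from left to right. Fix generators $s_1,\dots,s_{2g}$ of $\pi_1(S,x)$,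 and for each element of $\pi_1(S,x)$ a word in the $s_i$ that represents it. For each $\alpha\in\mathcal D$ put $x_\alpha=\alpha(0)$ and fix a path $\lambda_\alpha$ in $S$ from $x$ to $x_\alpha$. The dual loop of $\alpha$ is the loop $a=(f\circ\lambda_\alpha)(f\circ\lambda_{\tau\alpha})^{-1}$ in $\Sigma$ based at $f(x)$; the dual loop of $\alpha_i$ is denoted $a_i$, that of $\tau\alpha$ is denoted $\tau a$. For each triple point, label its triplet $P_1,P_2,P_3$ and choose $\alpha,\beta,\gamma\in\mathcal D$ and $u,v,w\in(0,1]$ with $$\alpha(u)=P_1=(\tau\gamma)(w),\qquad \beta(v)=P_2=(\tau\alpha)(u),\qquad \gamma(w)=P_3=(\tau\beta)(v),$$ and paths $\omega_n$ in $S$ from $x$ to $P_n$ ($n=1,2,3$). Let $d_\alpha=\alpha|_{[u,1]}$, $d_{\tau\alpha}=(\tau\alpha)|_{[u,1]}$, and similarly $d_\beta,d_{\tau\beta}$ on $[v,1]$ and $d_\gamma,d_{\tau\gamma}$ on $[w,1]$; put $$t_\alpha=\omega_1d_\alpha\lambda_\alpha^{-1},\quad t_{\tau\alpha}=\omega_2d_{\tau\alpha}\lambda_{\tau\alpha}^{-1},\quad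 t_\beta=\omega_2d_\beta\lambda_\beta^{-1},\quad t_{\tau\beta}=\omega_3d_{\tau\beta}\lambda_{\tau\beta}^{-1},\quad t_\gamma=\omega_3d_\gamma\lambda_\gamma^{-1},\quad t_{\tau\gamma}=\omega_1d_{\tau\gamma}\lambda_{\tau\gamma}^{-1}.$$ **Relations** (loops in $S$ are replaced by the chosen words in the $s_i$): - (R1) dual loop relations: $\tau a=a^{-1}$ for each $\alpha\in\mathcal D$; - (R2) triple point relations: $t_\alpha\,a\,t_{\tau\alpha}^{-1}\;t_\beta\,b\,t_{\tau\beta}^{-1}\;t_\gamma\,c\,t_{\tau\gamma}^{-1}=1$, one for each triple point, where $a,b,c$ are the generators that correspond to $\alpha,\beta,\gamma$; - (R3) double curve relations: $\lambda_\alpha\alpha\lambda_\alpha^{-1}=a\,(\lambda_{\tau\alpha}\,\tau\alpha\,\lambda_{\tau\alpha}^{-1})\,a^{-1}$ for each $\alpha\in\mathcal D$, where $\alpha$ and $\tau\alpha$ also denote the loops traversed once from $x_\alpha$ and $x_{\tau\alpha}$; - (R4) surface relations: the relations of the $s_i$ in $\pi_1(S,x)$ (all of them, or any set of defining relations). **Theorem.**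 For every (pseudo) Dehn $g$-torus $\Sigma$ with Johansson diagram $\mathcal D=\{\alpha_1,\dots,\alpha_{2k}\}$ and all choices as above, the fundamental group $\pi_1(\Sigma,f(x))$ is isomorphic to $$\pi(\mathcal D)=\langle\, s_1,\dots,s_{2g},a_1,\dots,a_{2k}\mid \text{R1, R2, R3 and R4}\,\rangle,$$ by an isomorphism that sends each generator $s_i$ to $f_*(s_i)$ and each generator $a_i$ to the class of the dual loop $a_i$. -/

import Mathlib

open scoped Manifold ContDiff unitInterval
open Set

universe u v

noncomputable section

/-! ### Fundamental groups with the concatenation product -/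

/-- The fundamental group `π₁(X, x)`, where the product of two loops is their concatenation from
left to right. (The product of `FundamentalGroup X x` concatenates in the reverse order, so the
opposite group is taken.) -/
abbrev Pi1 (X : Type*) [TopologicalSpace X] (x : X) : Type _ := (FundamentalGroup X x)ᵐᵒᵖ

namespace Pi1

/-- The class of a loop. -/
def ofPath {X : Type*} [TopologicalSpace X] {x : X} (p : Path x x) : Pi1 X x :=
  MulOpposite.op (FundamentalGroup.fromPath (Path.Homotopic.Quotient.mk p))

theorem ofPath_trans {X : Type*} [TopologicalSpace X] {x : X} (p q : Path x x) :
    ofPath (p.trans q) = ofPath p * ofPath q := rfl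

theorem ofPath_symm {X : Type*} [TopologicalSpace X] {x : X} (p : Path x x) :
    ofPath p.symm = (ofPath p)⁻¹ := rfl

/-- The homomorphism induced by a continuous map. -/
def map {X Y : Type*} [TopologicalSpace X] [TopologicalSpace Y] (f : C(X, Y)) (x : X) :
    Pi1 X x →* Pi1 Y (f x) :=
  MonoidHom.op (FundamentalGroup.map f x)

theorem map_ofPath {X Y : Type*} [TopologicalSpace X] [TopologicalSpace Y] (f : C(X, Y)) {x : X}
    (p : Path x x) : map f x (ofPath p) = ofPath (p.map f.continuous) := rfl

end Pi1

/-! ### Orientability and genus -/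

/-- A smooth `n`-manifold is orientable if it is covered by charts of its smooth structure all of
whose coordinate changes have positive Jacobian determinant. -/
def IsOrientable (n : ℕ) (X : Type*) [TopologicalSpace X]
    [ChartedSpace (EuclideanSpace ℝ (Fin n)) X] : Prop :=
  ∃ A ⊆ IsManifold.maximalAtlas (𝓡 n) ∞ X,
    (∀ x : X, ∃ e ∈ A, x ∈ e.source) ∧
    ∀ e ∈ A, ∀ e' ∈ A, ∀ y ∈ (e.symm.trans e').source,
      0 < (fderiv ℝ (e.symm.trans e') y).det

/-- The first singular homology group with integer coefficients. -/
def H1 (X : Type u) [TopologicalSpace X] : ModuleCat.{u} ℤ :=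
  ((AlgebraicTopology.singularHomologyFunctor (ModuleCat.{u} ℤ) 1).obj
    (ModuleCat.of ℤ (ULift.{u} ℤ))).obj (TopCat.of X)

/-- A closed connected orientable surface has genus `g` if its first homology group is free
abelian of rank `2g`. -/
def HasGenus (S : Type u) [TopologicalSpace S] (g : ℕ) : Prop :=
  Nonempty (H1 S ≃ₗ[ℤ] (Fin (2 * g) → ℤ))

/-! ### Diagrams -/

/-- `2k` parametrized closed curves `ℝ → S` of period `1`, paired by a map `sister`. The points
`curve i t` and `curve (sister i) t` are to be identified. -/
structure SisteredCurves (S : Type*) (k : ℕ) where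
  curve : Fin (2 * k) → ℝ → S
  sister : Fin (2 * k) → Fin (2 * k)
  periodic : ∀ i, Function.Periodic (curve i) 1

namespace SisteredCurves

variable {S : Type*} {k : ℕ} (D : SisteredCurves S k)

/-- The branches of curves passing through `P`: a branch is a curve with a parameter modulo `1`,
represented in `(0, 1]`. -/
def branches (P : S) : Set (Fin (2 * k) × ℝ) :=
  {b | b.2 ∈ Ioc (0 : ℝ) 1 ∧ D.curve b.1 b.2 = P}

/-- The equivalence relation on `S` generated by identifying sister curves pointwise. -/
def related : Setoid S :=
  Relation.EqvGen.setoid (fun P Q => ∃ i t, P = D.curve i t ∧ Q = D.curve (D.sister i) t)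

/-- The velocity vector of a curve (read in the preferred chart at the point `curve i t`). -/
def velocity [TopologicalSpace S] [ChartedSpace (EuclideanSpace ℝ (Fin 2)) S]
    (i : Fin (2 * k)) (t : ℝ) : EuclideanSpace ℝ (Fin 2) :=
  mfderiv 𝓘(ℝ, ℝ) (𝓡 2) (D.curve i) t (1 : ℝ)

end SisteredCurves

/-- An (abstract) Johansson diagram on the surface `S`: `2k` smoothly immersed closed curves which
cross themselves and each other only at transverse crossings of two branches, with a free
involution (the sistering) and coherent parametrizations of sister curves, such that the points of
the diagram are identified in pairs, except for the crossings, which are identified in triplets. -/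
structure JohanssonDiagram (S : Type*) [TopologicalSpace S]
    [ChartedSpace (EuclideanSpace ℝ (Fin 2)) S] (k : ℕ) extends SisteredCurves S k where
  sister_sister : ∀ i, sister (sister i) = i
  sister_ne : ∀ i, sister i ≠ i
  smooth : ∀ i, ContMDiff 𝓘(ℝ, ℝ) (𝓡 2) ∞ (curve i)
  immersed : ∀ i t, toSisteredCurves.velocity i t ≠ 0
  branches_le_two : ∀ P, (toSisteredCurves.branches P).encard ≤ 2
  transverse : ∀ P, ∀ b ∈ toSisteredCurves.branches P, ∀ b' ∈ toSisteredCurves.branches P,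
    b ≠ b' → LinearIndependent ℝ
      ![toSisteredCurves.velocity b.1 b.2, toSisteredCurves.velocity b'.1 b'.2]
  pairs : ∀ P, (toSisteredCurves.branches P).encard = 1 →
    {Q | toSisteredCurves.related P Q}.encard = 2
  triplets : ∀ P, (toSisteredCurves.branches P).encard = 2 →
    {Q | toSisteredCurves.related P Q}.encard = 3

namespace JohanssonDiagram

variable {S : Type*} [TopologicalSpace S] [ChartedSpace (EuclideanSpace ℝ (Fin 2)) S] {k : ℕ}
  (D : JohanssonDiagram S k)

/-- The pseudo Dehn surface of the diagram: the quotient space of `S` under the relation defined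
by the diagram. -/
abbrev PseudoDehnSurface : Type _ := Quotient D.related

/-- The projection of `S` onto the pseudo Dehn surface. -/
def proj : C(S, D.PseudoDehnSurface) := ⟨Quotient.mk D.related, continuous_quotient_mk'⟩

theorem proj_curve (i : Fin (2 * k)) (t : ℝ) :
    D.proj (D.curve i t) = D.proj (D.curve (D.sister i) t) :=
  Quotient.sound (Relation.EqvGen.rel _ _ ⟨i, t, rfl, rfl⟩)

/-- The triple points. -/
abbrev TriplePoint : Type _ := {P : D.PseudoDehnSurface // {Q : S | D.proj Q = P}.encard = 3}

theorem curve_continuous (i : Fin (2 * k)) : Continuous (D.curve i) := (D.smooth i).continuous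

theorem curve_one (i : Fin (2 * k)) : D.curve i 1 = D.curve i 0 := by
  simpa using D.periodic i 0

/-- The path that travels from the point `P = curve i u` (`0 < u ≤ 1`) along the curve `i` in the
positive sense until it reaches the basepoint `curve i 0 = curve i 1`. -/
def tail (i : Fin (2 * k)) (u : ℝ) {P : S} (h : D.curve i u = P) : Path P (D.curve i 0) where
  toFun t := D.curve i (u + t * (1 - u))
  continuous_toFun := (D.curve_continuous i).comp (by fun_prop)
  source' := by simp [h]
  target' := by simp [D.curve_one i]

/-- The curve `i`, as a loop at its basepoint `curve i 0`. -/
def loop (i : Fin (2 * k)) : Path (D.curve i 0) (D.curve i 0) where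
  toFun t := D.curve i t
  continuous_toFun := (D.curve_continuous i).comp (by fun_prop)
  source' := by simp
  target' := by simp [D.curve_one i]

/-- A labelling of the three crossings `P₁, P₂, P₃` of the triplet of the triple point `P` and of
the branches through them: `α` and `τγ` meet at `P₁`, `β` and `τα` at `P₂`, `γ` and `τβ` at `P₃`;
`u, v, w` are the parameters of the three pairs of sister branches. It comes with paths
`q₁, q₂, q₃` from `x` to the crossings. -/
structure TripletLabelling (x : S) (P : D.TriplePoint) where
  (α β γ : Fin (2 * k))
  (u v w : ℝ)
  (P₁ P₂ P₃ : S)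
  triplet : ({P₁, P₂, P₃} : Set S) = {Q | D.proj Q = P.1}
  hu : u ∈ Ioc (0 : ℝ) 1
  hv : v ∈ Ioc (0 : ℝ) 1
  hw : w ∈ Ioc (0 : ℝ) 1
  hα : D.curve α u = P₁
  hα' : D.curve (D.sister α) u = P₂
  hβ : D.curve β v = P₂
  hβ' : D.curve (D.sister β) v = P₃
  hγ : D.curve γ w = P₃
  hγ' : D.curve (D.sister γ) w = P₁
  q₁ : Path x P₁
  q₂ : Path x P₂
  q₃ : Path x P₃

/-- The choices on which the presentation depends. The basepoint of the `i`-th curve is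
`curve i 0`, so that basepoints of sister curves are related. -/
structure Choices (g : ℕ) (x : S) where
  /-- the surface generators, elements of `π₁(S, x)` -/
  s : Fin (2 * g) → Pi1 S x
  /-- a word in the generators for each element of `π₁(S, x)`; in particular they generate -/
  word : Pi1 S x → FreeGroup (Fin (2 * g))
  lift_word : ∀ c, FreeGroup.lift s (word c) = c
  /-- the surface relators: a set of defining relations for the `s i` in `π₁(S, x)`, for
  instance all relations that hold there -/
  surfaceRel : Set (FreeGroup (Fin (2 * g)))
  normalClosure_surfaceRel : Subgroup.normalClosure surfaceRel = (FreeGroup.lift s).ker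
  /-- the joining arcs -/
  lam : ∀ i, Path x (D.curve i 0)
  /-- the labelling and the paths used for the relation at each triple point -/
  labelling : ∀ P : D.TriplePoint, D.TripletLabelling x P

namespace Choices

variable {D} {g : ℕ} {x : S} (c : D.Choices g x)

/-- The free generator `a_i`. -/
def a (i : Fin (2 * k)) : FreeGroup (Fin (2 * g) ⊕ Fin (2 * k)) := FreeGroup.of (Sum.inr i)

/-- The word in the surface generators that expresses the class of a loop in `S`. -/
def surfaceWord (p : Path x x) : FreeGroup (Fin (2 * g) ⊕ Fin (2 * k)) :=
  FreeGroup.map Sum.inl (c.word (Pi1.ofPath p))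

/-- The loop `t = q d λ⁻¹` in `S` where `d` follows the curve `i` from `P` to its basepoint. -/
def tLoop {P : S} (q : Path x P) (i : Fin (2 * k)) (u : ℝ) (h : D.curve i u = P) : Path x x :=
  (q.trans (D.tail i u h)).trans (c.lam i).symm

/-- The loop `λ α λ⁻¹` in `S`, where `α` is the `i`-th curve. -/
def curveLoop (i : Fin (2 * k)) : Path x x :=
  ((c.lam i).trans (D.loop i)).trans (c.lam i).symm

/-- R1: `τa = a⁻¹`. -/
def dualLoopRelator (_c : D.Choices g x) (i : Fin (2 * k)) :
    FreeGroup (Fin (2 * g) ⊕ Fin (2 * k)) :=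
  a (D.sister i) * a i

/-- R2: `t_α a t_{τα}⁻¹ t_β b t_{τβ}⁻¹ t_γ c t_{τγ}⁻¹ = 1`. -/
def triplePointRelator (P : D.TriplePoint) : FreeGroup (Fin (2 * g) ⊕ Fin (2 * k)) :=
  let L := c.labelling P
  (c.surfaceWord (c.tLoop L.q₁ L.α L.u L.hα) * a L.α *
      (c.surfaceWord (c.tLoop L.q₂ (D.sister L.α) L.u L.hα'))⁻¹) *
    (c.surfaceWord (c.tLoop L.q₂ L.β L.v L.hβ) * a L.β *
      (c.surfaceWord (c.tLoop L.q₃ (D.sister L.β) L.v L.hβ'))⁻¹) *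
    (c.surfaceWord (c.tLoop L.q₃ L.γ L.w L.hγ) * a L.γ *
      (c.surfaceWord (c.tLoop L.q₁ (D.sister L.γ) L.w L.hγ'))⁻¹)

/-- R3: `α = a τα a⁻¹`. -/
def doubleCurveRelator (i : Fin (2 * k)) : FreeGroup (Fin (2 * g) ⊕ Fin (2 * k)) :=
  c.surfaceWord (c.curveLoop i) *
    (a i * c.surfaceWord (c.curveLoop (D.sister i)) * (a i)⁻¹)⁻¹

/-- All relators; the last set is R4. -/
def relators : Set (FreeGroup (Fin (2 * g) ⊕ Fin (2 * k))) :=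
  range c.dualLoopRelator ∪ range c.triplePointRelator ∪ range c.doubleCurveRelator ∪
    FreeGroup.map Sum.inl '' c.surfaceRel

/-- The group `π(D)` with generators `s_1, …, s_{2g}, a_1, …, a_{2k}` and relators R1–R4. -/
abbrev group : Type := PresentedGroup c.relators

/-- The preferred dual loop `λ_α λ_{τα}⁻¹` of the `i`-th curve, in the image of a map `f` which
identifies sister curves pointwise. -/
def dualLoop {X : Type*} [TopologicalSpace X] (f : C(S, X))
    (hf : ∀ i t, f (D.curve i t) = f (D.curve (D.sister i) t)) (i : Fin (2 * k)) :
    Path (f x) (f x) :=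
  ((c.lam i).map f.continuous).trans
    (((c.lam (D.sister i)).map f.continuous).symm.cast (hf i 0) rfl)

/-- `π(D)` is isomorphic to `π₁(X, f x)`, by an isomorphism which sends the generator `s_i` to the
image of the surface loop `s_i` and the generator `a_i` to the preferred dual loop of the `i`-th
curve. -/
def Presents {X : Type*} [TopologicalSpace X] (f : C(S, X))
    (hf : ∀ i t, f (D.curve i t) = f (D.curve (D.sister i) t)) : Prop :=
  ∃ e : c.group ≃* Pi1 X (f x),
    (∀ i, e (PresentedGroup.of (Sum.inl i)) = Pi1.map f x (c.s i)) ∧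
    ∀ i, e (PresentedGroup.of (Sum.inr i)) = Pi1.ofPath (c.dualLoop f hf i)

end Choices

end JohanssonDiagram

/-! ### Dehn surfaces -/

section Dehn

variable {S M : Type*} [TopologicalSpace S] [ChartedSpace (EuclideanSpace ℝ (Fin 2)) S]
  [TopologicalSpace M] [ChartedSpace (EuclideanSpace ℝ (Fin 3)) M]

/-- The tangent plane at `f x` of the sheet of `f` through `x`. -/
def tangentPlane (f : S → M) (x : S) : Submodule ℝ (EuclideanSpace ℝ (Fin 3)) :=
  LinearMap.range (mfderiv (𝓡 2) (𝓡 3) f x).toLinearMap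

/-- A general position immersion of a surface in a 3-manifold: its only singularities are
transverse double points and transverse triple points. Its image is a Dehn surface. -/
structure IsGeneralPositionImmersion (f : S → M) : Prop where
  smooth : ContMDiff (𝓡 2) (𝓡 3) ∞ f
  immersion : ∀ x, Function.Injective (mfderiv (𝓡 2) (𝓡 3) f x)
  fiber_le_three : ∀ p, (f ⁻¹' {p}).encard ≤ 3
  double : ∀ x y, x ≠ y → f x = f y → tangentPlane f x ⊔ tangentPlane f y = ⊤
  triple : ∀ x y z, x ≠ y → y ≠ z → x ≠ z → f x = f y → f y = f z →
    tangentPlane f x ⊓ tangentPlane f y ⊓ tangentPlane f z = ⊥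

/-- `D` is the Johansson diagram of the Dehn surface parametrized by `f`: two points of `S` have
the same image under `f` if and only if they are related by `D`. -/
def JohanssonDiagram.IsDiagramOf {k : ℕ} (D : JohanssonDiagram S k) (f : S → M) : Prop :=
  ∀ x y, f x = f y ↔ D.related x y

/-- A general position immersion, as a map onto the Dehn surface `range f` it parametrizes. -/
def IsGeneralPositionImmersion.toRange {f : S → M} (hf : IsGeneralPositionImmersion f) :
    C(S, range f) :=
  ⟨rangeFactorization f, hf.smooth.continuous.rangeFactorization⟩

theorem JohanssonDiagram.IsDiagramOf.toRange_curve {k : ℕ} {D : JohanssonDiagram S k} {f : S → M}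
    (hf : IsGeneralPositionImmersion f) (hD : D.IsDiagramOf f) (i : Fin (2 * k)) (t : ℝ) :
    hf.toRange (D.curve i t) = hf.toRange (D.curve (D.sister i) t) :=
  Subtype.ext ((hD _ _).2 (Relation.EqvGen.rel _ _ ⟨i, t, rfl, rfl⟩))

end Dehn

end

noncomputable section

/-! ### Representations of the paths of a space in a group -/

/-- A functor from the fundamental groupoid of `Y` to a group, given on paths. -/
structure PathRep (Y : Type*) [TopologicalSpace Y] (G : Type*) [Group G] where
  /-- The value on a path. -/
  toFun : ∀ ⦃y z : Y⦄, Path y z → G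
  map_trans : ∀ {y z w : Y} (p : Path y z) (q : Path z w), toFun (p.trans q) = toFun p * toFun q
  map_homotopic : ∀ {y z : Y} {p q : Path y z}, p.Homotopic q → toFun p = toFun q

namespace PathRep

variable {Y Z : Type*} [TopologicalSpace Y] [TopologicalSpace Z] {G H : Type*} [Group G] [Group H]
  (V : PathRep Y G)

instance : CoeFun (PathRep Y G) fun _ => ∀ ⦃y z : Y⦄, Path y z → G := ⟨toFun⟩

theorem map_congr {y z y' z' : Y} {p : Path y z} {q : Path y' z'} (h : ∀ t, p t = q t) :
    V p = V q := by
  obtain rfl : y = y' := by simpa using h 0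
  obtain rfl : z = z' := by simpa using h 1
  congr 1
  ext t
  exact h t

@[simp] theorem map_refl (y : Y) : V (Path.refl y) = 1 := by
  have h := V.map_trans (Path.refl y) (Path.refl y)
  rw [Path.refl_trans_refl] at h
  simpa using h

theorem map_const {y z : Y} {p : Path y z} (h : ∀ t, p t = y) : V p = 1 := by
  rw [← V.map_refl y]
  exact V.map_congr h

@[simp] theorem map_symm {y z : Y} (p : Path y z) : V p.symm = (V p)⁻¹ := by
  refine eq_inv_of_mul_eq_one_right ?_
  rw [← V.map_trans, ← V.map_refl y]
  exact V.map_homotopic ⟨(Path.Homotopy.reflTransSymm p).symm⟩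

@[simp] theorem map_cast {y z y' z' : Y} (p : Path y z) (hy : y' = y) (hz : z' = z) :
    V (p.cast hy hz) = V p :=
  V.map_congr fun _ => rfl

/-- The values on two paths that are images of paths with the same ends in a simply connected
space agree. -/
theorem map_eq_of_simplyConnected [SimplyConnectedSpace Z] (f : C(Z, Y)) {a b : Z}
    (p q : Path a b) : V (p.map f.continuous) = V (q.map f.continuous) :=
  V.map_homotopic ((SimplyConnectedSpace.paths_homotopic p q).map f)

/-- The boundary relation of a square. -/
theorem map_square {h : I → I → Y} (hh : Continuous (Function.uncurry h))
    {a b c d : Y} {p₀ : Path a b} {p₁ : Path c d} {q₀ : Path a c} {q₁ : Path b d}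
    (hp₀ : ∀ s, p₀ s = h s 0) (hp₁ : ∀ s, p₁ s = h s 1) (hq₀ : ∀ r, q₀ r = h 0 r)
    (hq₁ : ∀ r, q₁ r = h 1 r) : V p₀ * V q₁ = V q₀ * V p₁ := by
  have : ContractibleSpace I := (convex_Icc (0 : ℝ) 1).contractibleSpace ⟨0, by simp⟩
  let i : Path (0 : I) 1 := ⟨⟨id, continuous_id⟩, rfl, rfl⟩
  let f : C(I × I, Y) := ⟨_, hh⟩
  have key := V.map_eq_of_simplyConnected f ((i.prod (Path.refl 0)).trans ((Path.refl 1).prod i))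
    (((Path.refl 0).prod i).trans (i.prod (Path.refl 1)))
  rw [Path.map_trans, Path.map_trans, V.map_trans, V.map_trans] at key
  convert key using 2
  · exact V.map_congr fun t => hp₀ t
  · exact V.map_congr fun t => hq₁ t
  · exact V.map_congr fun t => hq₀ t
  · exact V.map_congr fun t => hp₁ t

/-- Pull back along a continuous map. -/
def comap (f : C(Z, Y)) : PathRep Z G where
  toFun _ _ p := V (p.map f.continuous)
  map_trans p q := by rw [Path.map_trans, V.map_trans]
  map_homotopic h := V.map_homotopic (h.map f)

/-- Push forward along a homomorphism. -/
def mapHom (φ : G →* H) : PathRep Y H where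
  toFun _ _ p := φ (V p)
  map_trans p q := by rw [V.map_trans, φ.map_mul]
  map_homotopic h := by rw [V.map_homotopic h]

/-- Change of gauge. -/
def gauge (j : Y → G) : PathRep Y G where
  toFun y z p := j y * V p * (j z)⁻¹
  map_trans p q := by rw [V.map_trans]; group
  map_homotopic h := by rw [V.map_homotopic h]

@[simp] theorem comap_apply (f : C(Z, Y)) {y z : Z} (p : Path y z) :
    V.comap f p = V (p.map f.continuous) := rfl

@[simp] theorem mapHom_apply (φ : G →* H) {y z : Y} (p : Path y z) :
    V.mapHom φ p = φ (V p) := rfl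

@[simp] theorem gauge_apply (j : Y → G) {y z : Y} (p : Path y z) :
    V.gauge j p = j y * V p * (j z)⁻¹ := rfl

/-- The homomorphism on the fundamental group. -/
def toPi1 (x : Y) : Pi1 Y x →* G where
  toFun c := Quotient.lift (fun p : Path x x => V p) (fun _ _ h => V.map_homotopic h) c.unop
  map_one' := V.map_refl x
  map_mul' := by
    rintro ⟨⟨p⟩⟩ ⟨⟨q⟩⟩
    exact V.map_trans p q

@[simp] theorem toPi1_ofPath {x : Y} (p : Path x x) : V.toPi1 x (Pi1.ofPath p) = V p := rfl

end PathRep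

theorem Pi1.ofPath_surjective {X : Type*} [TopologicalSpace X] {x : X} :
    Function.Surjective (Pi1.ofPath (x := x)) := by
  rintro ⟨⟨p⟩⟩
  exact ⟨p, rfl⟩

open CategoryTheory in
/-- The representation of paths as loops, by means of chosen paths from the base point. -/
theorem PathRep.exists_canonical {Y : Type*} [TopologicalSpace Y] [PathConnectedSpace Y] (x : Y) :
    ∃ V : PathRep Y (Pi1 Y x), ∀ p : Path x x, V p = Pi1.ofPath p := by
  let m (y : Y) : FundamentalGroupoid.mk x ⟶ FundamentalGroupoid.mk y :=
    Path.Homotopic.Quotient.mk (PathConnectedSpace.somePath x y)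
  let F (y : Y) := inv (m x) ≫ m y
  let arrow {y z : Y} (p : Path y z) : FundamentalGroupoid.mk y ⟶ FundamentalGroupoid.mk z :=
    Path.Homotopic.Quotient.mk p
  refine ⟨⟨fun y z p => MulOpposite.op (F y ≫ arrow p ≫ inv (F z)), ?_, ?_⟩, ?_⟩
  · intro y z w p q
    have : arrow (p.trans q) = arrow p ≫ arrow q := rfl
    rw [this]
    change _ = MulOpposite.op ((F y ≫ arrow p ≫ inv (F z)) ≫ (F z ≫ arrow q ≫ inv (F w)))
    simp
  · intro y z p q h
    have : arrow p = arrow q := Quotient.sound h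
    rw [this]
  · intro p
    change MulOpposite.op (F x ≫ arrow p ≫ inv (F x)) = MulOpposite.op (arrow p)
    simp [F]

/-- Two representations that agree on the loops at one point differ by a change of gauge. -/
theorem PathRep.exists_gauge_of_eq_on_loops {Y G : Type*} [TopologicalSpace Y]
    [PathConnectedSpace Y] [Group G] (E F : PathRep Y G) {x : Y}
    (hEF : ∀ p : Path x x, E p = F p) :
    ∃ h : Y → G, h x = 1 ∧ ∀ {y z : Y} (p : Path y z), E p = h y * F p * (h z)⁻¹ := by
  let μ (y : Y) : Path x y := PathConnectedSpace.somePath x y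
  refine ⟨fun y => (E (μ y))⁻¹ * F (μ y), by simp [hEF], fun {y z} p => ?_⟩
  have := hEF (((μ y).trans p).trans (μ z).symm)
  simp only [map_trans, map_symm] at this
  calc E p = (E (μ y))⁻¹ * (E (μ y) * E p * (E (μ z))⁻¹) * E (μ z) := by group
    _ = _ := by rw [this]; group

/-! ### Local to global -/

/-- A property of paths that is invariant under homotopy and passes to concatenations holds for
all paths if it holds for all small paths. -/
theorem Path.induction_of_cover {Y ι : Type*} [TopologicalSpace Y] {U : ι → Set Y}
    (hU : ∀ i, IsOpen (U i)) (hcov : ∀ y, ∃ i, y ∈ U i)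
    (Q : ∀ {y z : Y}, Path y z → Prop)
    (hhom : ∀ {y z : Y} {p q : Path y z}, p.Homotopic q → Q p → Q q)
    (htrans : ∀ {y z w : Y} {p : Path y z} {q : Path z w}, Q p → Q q → Q (p.trans q))
    (hsmall : ∀ {y z : Y} (p : Path y z) (i : ι), (∀ t, p t ∈ U i) → Q p)
    {y z : Y} (p : Path y z) : Q p := by
  obtain ⟨t, ht0, htm, ⟨n, hn⟩, hsub⟩ := exists_monotone_Icc_subset_open_cover_unitInterval
    (c := fun i => p ⁻¹' U i) (fun i => (hU i).preimage p.continuous)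
    (fun s _ => by simpa using hcov (p s))
  have key : ∀ m, Q (p.subpath (t 0) (t m)) := by
    intro m
    induction m with
    | zero =>
      obtain ⟨i, hi⟩ := hcov (p (t 0))
      refine hsmall _ i fun s => ?_
      rw [Path.subpath_self]
      exact hi
    | succ m ih =>
      obtain ⟨i, hi⟩ := hsub m
      refine hhom ⟨Path.Homotopy.subpathTransSubpath p (t 0) (t m) (t (m + 1))⟩ (htrans ih ?_)
      refine hsmall _ i fun s => ?_
      have : p.subpath (t m) (t (m + 1)) s ∈ range (p.subpath (t m) (t (m + 1))) := ⟨s, rfl⟩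
      rw [Path.range_subpath_of_le _ _ _ (htm (Nat.le_succ m))] at this
      obtain ⟨r, hr, hr'⟩ := this
      rw [← hr']
      exact hi hr
  have h1 := key n
  rw [ht0, hn n le_rfl, Path.subpath_zero_one] at h1
  have aux : ∀ {y z y' z' : Y} (p : Path y z) (hy : y' = y) (hz : z' = z),
      Q (p.cast hy hz) → Q p := by
    rintro y z _ _ p rfl rfl h
    exact h
  exact aux _ _ _ h1

section LocalGauge

variable {X ι G : Type*} [TopologicalSpace X] [Group G] {U : ι → Set X}
  (hU : ∀ i, IsOpen (U i)) (ix : X → ι) (hix : ∀ y, y ∈ U (ix y)) (ψ : ι → X → G)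
  (hψ : ∀ i j, ∀ y ∈ U i ∩ U j, ∀ᶠ z in nhds y,
    ψ i z * (ψ j z)⁻¹ = ψ i y * (ψ j y)⁻¹)

/-- The covering space with fibre the discrete group `G` and the transition functions
`ψ i * (ψ j)⁻¹`. -/
def gaugeBundleCore [TopologicalSpace G] [DiscreteTopology G] : FiberBundleCore ι X G where
  baseSet := U
  isOpen_baseSet := hU
  indexAt := ix
  mem_baseSet_at := hix
  coordChange i j y h := h * (ψ i y * (ψ j y)⁻¹)
  coordChange_self i y _ v := by simp
  continuousOn_coordChange i j := by
    rintro ⟨y, h⟩ ⟨hy, -⟩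
    refine ContinuousAt.continuousWithinAt ?_
    have h1 : ContinuousAt (fun p : X × G => p.2 * (ψ i y * (ψ j y)⁻¹)) (y, h) :=
      (continuous_of_discreteTopology (f := fun g : G => g * (ψ i y * (ψ j y)⁻¹))).continuousAt.comp
        continuousAt_snd
    refine h1.congr ?_
    filter_upwards [(continuousAt_fst (p := (y, h))).eventually (hψ i j y hy)] with p hp
    rw [hp]
  coordChange_comp i j k y _ v := by group

include hU hix hψ in
theorem PathRep.exists_of_local_gauge :
    ∃ V : PathRep X G, ∀ {y z : X} (p : Path y z) (i : ι), (∀ t, p t ∈ U i) →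
      V p = (ψ i y)⁻¹ * ψ i z := by
  let _ : TopologicalSpace G := ⊥
  have : DiscreteTopology G := ⟨rfl⟩
  let B := gaugeBundleCore hU ix hix ψ hψ
  have cov : IsCoveringMap B.proj := FiberBundle.isCoveringMap (F := G) (E := B.Fiber)
  let val (e : B.TotalSpace) : G := (show G from e.2) * ψ (ix e.1) e.1
  have val_inj : ∀ {y : X} {e e' : B.proj ⁻¹' {y}}, val e = val e' → e = e' := by
    rintro y ⟨⟨y, h⟩, rfl⟩ ⟨⟨y', h'⟩, hy⟩ hv
    obtain rfl : y' = y := hy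
    have : h = h' := mul_right_cancel (b := ψ (ix y') y') hv
    rw [this]
  let pt (g : G) (y : X) : B.TotalSpace := ⟨y, g * (ψ (ix y) y)⁻¹⟩
  have val_pt : ∀ g y, val (pt g y) = g := fun g y => by simp [val, pt]
  let T (g : G) (e : B.TotalSpace) : B.TotalSpace := ⟨e.1, g * (show G from e.2)⟩
  have val_T : ∀ g e, val (T g e) = g * val e := fun g e => mul_assoc g _ _
  have T_cont : ∀ g, Continuous (T g) := by
    intro g
    rw [continuous_iff_continuousAt]
    intro e
    have h0 := (FiberBundle.continuousAt_totalSpace G (E := B.Fiber) id (x₀ := e)).1 continuousAt_id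
    rw [FiberBundle.continuousAt_totalSpace]
    refine ⟨h0.1, ?_⟩
    refine ((continuous_of_discreteTopology (f := fun k : G => g * k)).continuousAt.comp
      h0.2).congr (Filter.Eventually.of_forall fun e' => ?_)
    change g * ((show G from e'.2) * _) = g * (show G from e'.2) * _
    rw [mul_assoc]
    rfl
  let mon {y z : X} (p : Path y z) := cov.monodromy (Path.Homotopic.Quotient.mk p)
  have mon_of_lift : ∀ {y z : X} (p : Path y z) (e : B.proj ⁻¹' {y}) (Γ : C(I, B.TotalSpace)),
      B.proj ∘ Γ = p → Γ 0 = e → (mon p e : B.TotalSpace) = Γ 1 := by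
    intro y z p e Γ h1 h0
    have := (cov.eq_liftPath_iff' (γ := p) (e := e) (γ_0 := p.source.trans e.2.symm) (Γ := Γ)).2
      ⟨h1, h0⟩
    rw [this]
    rfl
  have mon_T : ∀ {y z : X} (p : Path y z) (g : G) (e e' : B.proj ⁻¹' {y}),
      (e' : B.TotalSpace) = T g e → (mon p e' : B.TotalSpace) = T g (mon p e) := by
    intro y z p g e e' he
    let Γ := cov.liftPath p e (p.source.trans e.2.symm)
    refine mon_of_lift p e' ⟨fun t => T g (Γ t), (T_cont g).comp Γ.continuous⟩ ?_ ?_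
    · exact cov.liftPath_lifts p e.1 (p.source.trans e.2.symm)
    · rw [he]
      exact congrArg (T g) (cov.liftPath_zero p e.1 (p.source.trans e.2.symm))
  have mon_val : ∀ {y z : X} (p : Path y z) (e : B.proj ⁻¹' {y}),
      val (mon p e) = val e * val (mon p ⟨pt 1 y, rfl⟩) := by
    intro y z p e
    rw [← val_T]
    refine congrArg val (mon_T p _ _ _ ?_)
    have : e = ⟨T (val e) (pt 1 y), rfl⟩ := val_inj (by simp [val_T, val_pt])
    rw [this, val_T, val_pt]
    simp
  refine ⟨⟨fun y z p => val (mon p ⟨pt 1 y, rfl⟩), ?_, ?_⟩, ?_⟩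
  · intro y z w p q
    have : mon (p.trans q) ⟨pt 1 y, rfl⟩ = mon q (mon p ⟨pt 1 y, rfl⟩) :=
      cov.monodromy_trans_apply (.mk p) (.mk q) _
    rw [this, mon_val]
  · intro y z p q h
    have : mon p = mon q := congrArg cov.monodromy (Quotient.sound h)
    rw [this]
  · intro y z p i hp
    let h := (ψ i y)⁻¹
    have hc : Continuous fun t => (B.localTriv i).toOpenPartialHomeomorph.symm (p t, h) := by
      refine ((B.localTriv i).toOpenPartialHomeomorph.symm.continuousOn).comp_continuous
        (by fun_prop) fun t => ?_
      change (p t, h) ∈ (B.localTriv i).target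
      rw [B.mem_localTriv_target]
      exact hp t
    have key := mon_of_lift p ⟨pt 1 y, rfl⟩ ⟨_, hc⟩ (by
      ext t
      simp [B.localTriv_symm_apply]) (by
      rw [ContinuousMap.coe_mk, B.localTriv_symm_apply, p.source]
      refine congrArg (fun g : G => (⟨y, g⟩ : B.TotalSpace)) ?_
      change (ψ i y)⁻¹ * (ψ i y * (ψ (ix y) y)⁻¹) = 1 * (ψ (ix y) y)⁻¹
      group)
    change val _ = _
    rw [key]
    rw [ContinuousMap.coe_mk, B.localTriv_symm_apply, p.target]
    change (ψ i y)⁻¹ * (ψ i z * (ψ (ix z) z)⁻¹) * ψ (ix z) z = _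
    group

end LocalGauge

/-! ### Representations of the paths of the quotient of a surface by a diagram -/

namespace JohanssonDiagram

variable {S : Type*} [TopologicalSpace S] [ChartedSpace (EuclideanSpace ℝ (Fin 2)) S] {k : ℕ}
  (D : JohanssonDiagram S k)

/-- The path along the curve `i` from the parameter `t` to the parameter `t'`. -/
def arc (i : Fin (2 * k)) (t t' : ℝ) : Path (D.curve i t) (D.curve i t') where
  toFun r := D.curve i (t + r * (t' - t))
  continuous_toFun := (D.curve_continuous i).comp (by fun_prop)
  source' := by simp
  target' := by simp

theorem related_curve (i : Fin (2 * k)) (t : ℝ) :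
    D.related (D.curve i t) (D.curve (D.sister i) t) :=
  Relation.EqvGen.rel _ _ ⟨i, t, rfl, rfl⟩

theorem mem_iff_of_related {A : Set S}
    (hA : ∀ i t, D.curve i t ∈ A → D.curve (D.sister i) t ∈ A) {y z : S} (h : D.related y z) :
    y ∈ A ↔ z ∈ A := by
  induction h with
  | rel y z h =>
    obtain ⟨i, t, rfl, rfl⟩ := h
    refine ⟨hA i t, fun h' => ?_⟩
    simpa [D.sister_sister] using hA _ t h'
  | refl => rfl
  | symm _ _ _ ih => exact ih.symm
  | trans _ _ _ _ _ ih ih' => exact ih.trans ih'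

variable {D} {X : Type*} [TopologicalSpace X]

/-- A neighbourhood `U` of `P` in a quotient of `S`, with a contraction to `P` that is induced by a
deformation in `S` which moves points of the diagram along the curves. -/
structure LocalContraction (D : JohanssonDiagram S k) (f : C(S, X)) (P : X) where
  /-- The neighbourhood. -/
  U : Set X
  isOpen_U : IsOpen U
  mem_U : P ∈ U
  /-- The deformation. -/
  h : S → I → S
  continuousOn_h : ContinuousOn (Function.uncurry h) ((f ⁻¹' U) ×ˢ univ)
  h_mem : ∀ z r, f z ∈ U → f (h z r) ∈ U
  h_one : ∀ z, f z ∈ U → h z 1 = z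
  h_zero : ∀ z, f z ∈ U → f (h z 0) = P
  h_curve : ∀ i t, f (D.curve i t) ∈ U → ∃ t₀, ∀ i', i' = i ∨ i' = D.sister i →
    ∀ r : I, h (D.curve i' t) r = D.curve i' (t₀ + r * (t - t₀))

namespace LocalContraction

variable {f : C(S, X)} {P : X} (C : D.LocalContraction f P)

/-- The path of a point under the deformation. -/
def track {z : S} (hz : f z ∈ C.U) : Path (C.h z 0) z where
  toFun r := C.h z r
  continuous_toFun := C.continuousOn_h.comp_continuous
    (f := fun r : I => (z, r)) (by fun_prop) fun _ => ⟨hz, trivial⟩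
  source' := rfl
  target' := C.h_one z hz

theorem map_track_mul {G : Type*} [Group G] (W : PathRep S G) [T1Space S]
    (hfin : (f ⁻¹' {P}).Finite) {z z' : S} (p : Path z z') (hp : ∀ t, f (p t) ∈ C.U)
    (hz : f z ∈ C.U) (hz' : f z' ∈ C.U) :
    W (C.track hz) * W p = W (C.track hz') := by
  have hc : Continuous (Function.uncurry fun s r : I => C.h (p s) r) :=
    C.continuousOn_h.comp_continuous (f := fun q : I × I => (p q.1, q.2)) (by fun_prop)
      fun q => ⟨hp q.1, trivial⟩
  let p₀ : Path (C.h z 0) (C.h z' 0) :=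
    ⟨⟨fun s => C.h (p s) 0, hc.comp (by fun_prop : Continuous fun s : I => (s, (0 : I)))⟩,
      by simp, by simp⟩
  have h₀ : W p₀ = 1 := by
    refine W.map_const fun t => ?_
    have hm : ∀ s, p₀ s ∈ f ⁻¹' {P} := fun s => C.h_zero _ (hp s)
    simpa using isPreconnected_univ.constant_of_mapsTo (f := p₀) hfin.isDiscrete
      p₀.continuous.continuousOn (fun s _ => hm s) (mem_univ t) (mem_univ 0)
  have := W.map_square hc (p₀ := p₀) (p₁ := p) (q₀ := C.track hz) (q₁ := C.track hz')
    (fun _ => rfl) (fun s => (C.h_one _ (hp s)).symm) (fun r => by rw [p.source]; rfl)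
    (fun r => by rw [p.target]; rfl)
  rw [← this, h₀, one_mul]

theorem map_track_curve {G : Type*} [Group G] (W : PathRep S G)
    (hW : ∀ i t t', W (D.arc i t t') = W (D.arc (D.sister i) t t')) (i : Fin (2 * k)) (t : ℝ)
    (hz : f (D.curve i t) ∈ C.U) (hz' : f (D.curve (D.sister i) t) ∈ C.U) :
    W (C.track hz) = W (C.track hz') := by
  obtain ⟨t₀, ht⟩ := C.h_curve i t hz
  calc W (C.track hz) = W (D.arc i t₀ t) := W.map_congr (ht i (.inl rfl))
    _ = W (D.arc (D.sister i) t₀ t) := hW i t₀ t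
    _ = W (C.track hz') := (W.map_congr (ht _ (.inr rfl))).symm

theorem map_track_related {G : Type*} [Group G] (W : PathRep S G)
    (hf : ∀ {y y'}, f y = f y' ↔ D.related y y')
    (hW : ∀ i t t', W (D.arc i t t') = W (D.arc (D.sister i) t t')) {z z' : S}
    (h : D.related z z') (hz : f z ∈ C.U) (hz' : f z' ∈ C.U) :
    W (C.track hz) = W (C.track hz') := by
  change Relation.EqvGen _ z z' at h
  induction h with
  | rel y y' h => obtain ⟨i, t, rfl, rfl⟩ := h; exact C.map_track_curve W hW i t hz hz'
  | refl => rfl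
  | symm y y' _ ih => exact (ih hz' hz).symm
  | trans y y' y'' h _ ih ih' =>
    have : f y' ∈ C.U := hf.2 h ▸ hz
    exact (ih hz this).trans (ih' this hz')

theorem related_h {z z' : S} (h : D.related z z')
    (hf : ∀ {y y'}, f y = f y' ↔ D.related y y') (hz : f z ∈ C.U) (r : I) :
    f (C.h z r) = f (C.h z' r) := by
  change Relation.EqvGen _ z z' at h
  induction h with
  | rel y y' h =>
    obtain ⟨i, t, rfl, rfl⟩ := h
    obtain ⟨t₀, ht⟩ := C.h_curve i t hz
    rw [ht i (.inl rfl), ht _ (.inr rfl)]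
    exact hf.2 (D.related_curve i _)
  | refl => rfl
  | symm y y' h ih => exact (ih (hf.2 h ▸ hz)).symm
  | trans y y' y'' h _ ih ih' => exact (ih hz).trans (ih' (hf.2 h ▸ hz))

end LocalContraction

/-- A representation of the paths of `S` that takes the same values on sister arcs descends. -/
theorem exists_descent [T1Space S] {f : C(S, X)} (hfs : Function.Surjective f)
    (hf : ∀ {y y'}, f y = f y' ↔ D.related y y') (hfin : ∀ P, (f ⁻¹' {P}).Finite)
    (hloc : ∀ P, ∀ N ∈ nhds P, ∃ C : D.LocalContraction f P, C.U ⊆ N)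
    {G : Type*} [Group G] (W : PathRep S G)
    (hW : ∀ i t t', W (D.arc i t t') = W (D.arc (D.sister i) t t')) :
    ∃ V : PathRep X G, ∀ {y z : S} (p : Path y z), V (p.map f.continuous) = W p := by
  choose C _ using fun P => hloc P univ Filter.univ_mem
  choose b hb using hfs
  let ψ (P q : X) : G :=
    open Classical in if h : f (b q) ∈ (C P).U then W ((C P).track h) else 1
  have hψ : ∀ P z (hz : f z ∈ (C P).U), ψ P (f z) = W ((C P).track hz) := by
    intro P z hz
    have h' : f (b (f z)) ∈ (C P).U := by rwa [hb]
    simp only [ψ, dif_pos h']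
    exact (C P).map_track_related W hf hW (hf.1 (hb _)) _ _
  have hψloc : ∀ P, ∀ q ∈ (C P).U, ∀ C' : D.LocalContraction f q, C'.U ⊆ (C P).U →
      ∀ z' (hz' : f z' ∈ C'.U), ψ P (f z') = ψ P q * W (C'.track hz') := by
    intro P q hq C' hC' z' hz'
    have h0 : f (C'.h z' 0) = q := C'.h_zero z' hz'
    have h0' : f (C'.h z' 0) ∈ (C P).U := by rwa [h0]
    have h2 : ψ P q = ψ P (f (C'.h z' 0)) := by rw [h0]
    rw [h2, hψ P z' (hC' hz'), hψ P _ h0']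
    exact ((C P).map_track_mul W (hfin P) _ (fun t => hC' (C'.h_mem z' t hz')) _ _).symm
  obtain ⟨V, hV⟩ := PathRep.exists_of_local_gauge (U := fun P => (C P).U) (fun P => (C P).isOpen_U)
    id (fun P => (C P).mem_U) ψ (by
      intro P Q q hq
      obtain ⟨C', hC'⟩ := hloc q ((C P).U ∩ (C Q).U)
        (((C P).isOpen_U.inter (C Q).isOpen_U).mem_nhds hq)
      filter_upwards [C'.isOpen_U.mem_nhds C'.mem_U] with q' hq'
      obtain ⟨z', rfl⟩ : ∃ z', f z' = q' := ⟨b q', hb q'⟩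
      rw [hψloc P q hq.1 C' (hC'.trans inter_subset_left) z' hq',
        hψloc Q q hq.2 C' (hC'.trans inter_subset_right) z' hq']
      group)
  refine ⟨V, fun {y z} p => ?_⟩
  refine Path.induction_of_cover (U := fun P => f ⁻¹' (C P).U)
    (fun P => (C P).isOpen_U.preimage f.continuous) (fun y => ⟨f y, (C (f y)).mem_U⟩)
    (fun {y z} p => V (p.map f.continuous) = W p) ?_ ?_ ?_ p
  · intro y z p q h e
    rw [← W.map_homotopic h, ← e]
    exact (V.map_homotopic (h.map f)).symm
  · intro y z w p q e e'
    rw [Path.map_trans, V.map_trans, W.map_trans, e, e']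
  · intro y z p P hp
    have hy : f y ∈ (C P).U := by simpa using hp 0
    have hz : f z ∈ (C P).U := by simpa using hp 1
    rw [hV _ P hp, hψ P y hy, hψ P z hz, ← (C P).map_track_mul W (hfin P) p hp hy hz]
    group

/-- The paths of the quotient are generated by the images of the paths of `S`. -/
theorem pathRep_mem_of_map_mem {f : C(S, X)} (hq : Topology.IsQuotientMap f)
    (hf : ∀ {y y'}, f y = f y' ↔ D.related y y')
    (hloc : ∀ P, Nonempty (D.LocalContraction f P))
    {G : Type*} [Group G] (V : PathRep X G) (K : Subgroup G)
    (hK : ∀ {y z : S} (p : Path y z), V (p.map f.continuous) ∈ K) {y z : X} (p : Path y z) :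
    V p ∈ K := by
  have C := fun P => (hloc P).some
  refine Path.induction_of_cover (U := fun P => (C P).U) (fun P => (C P).isOpen_U)
    (fun y => ⟨y, (C y).mem_U⟩) (fun {y z} p => V p ∈ K) ?_ ?_ ?_ p
  · intro y z p q h hp
    rwa [← V.map_homotopic h]
  · intro y z w p q h h'
    rw [V.map_trans]
    exact K.mul_mem h h'
  · intro y z p P hp
    choose b hb using hq.surjective
    have hqU : Topology.IsQuotientMap ((C P).U.restrictPreimage f) :=
      hq.restrictPreimage_isOpen (C P).isOpen_U
    let g (a : (C P).U × I) : X := f ((C P).h (b a.1) a.2)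
    have hgf : ∀ w (hw : f w ∈ (C P).U) r, g (⟨f w, hw⟩, r) = f ((C P).h w r) := fun w hw r =>
      (C P).related_h (hf.1 (hb (f w))) hf (by rwa [hb]) r
    have hg : Continuous g := by
      refine hqU.continuous_lift_prod_left ?_
      have : Continuous fun a : (f ⁻¹' (C P).U) × I => f ((C P).h a.1 a.2) :=
        f.continuous.comp ((C P).continuousOn_h.comp_continuous
          (f := fun a : (f ⁻¹' (C P).U) × I => (a.1.1, a.2)) (by fun_prop)
          fun a => ⟨a.1.2, trivial⟩)
      refine this.congr fun a => ?_
      exact (hgf a.1 a.1.2 a.2).symm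
    have hc : Continuous (Function.uncurry fun s r : I => g (⟨p s, hp s⟩, r)) :=
      hg.comp (by fun_prop)
    obtain ⟨w, rfl⟩ := hq.surjective y
    obtain ⟨w', rfl⟩ := hq.surjective z
    have hw : f w ∈ (C P).U := by simpa using hp 0
    have hw' : f w' ∈ (C P).U := by simpa using hp 1
    have hg0 : ∀ a, g (a, 0) = P := fun a => (C P).h_zero _ (by rw [hb]; exact a.2)
    have hg1 : ∀ a, g (a, 1) = a := fun a => by
      change f ((C P).h (b a) 1) = a
      rw [(C P).h_one _ (by rw [hb]; exact a.2), hb]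
    have key := V.map_square hc
      (p₀ := (Path.refl P).cast ((C P).h_zero w hw) ((C P).h_zero w' hw'))
      (p₁ := p) (q₀ := ((C P).track hw).map f.continuous)
      (q₁ := ((C P).track hw').map f.continuous) (fun s => (hg0 _).symm)
      (fun s => (hg1 ⟨p s, hp s⟩).symm)
      (fun r => by simp only [p.source, hgf]; rfl) (fun r => by simp only [p.target, hgf]; rfl)
    rw [V.map_cast, V.map_refl, one_mul] at key
    have : V p = (V (((C P).track hw).map f.continuous))⁻¹ *
        V (((C P).track hw').map f.continuous) := by rw [key]; group
    rw [this]
    exact K.mul_mem (K.inv_mem (hK _)) (hK _)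

end JohanssonDiagram

/-! ### Charts that straighten the curves of a diagram -/

/-- Two transverse curves through a point of the plane are the axes of a coordinate system. -/
theorem exists_openPartialHomeomorph_of_transverse {c₁ c₂ : ℝ → EuclideanSpace ℝ (Fin 2)}
    {v₁ v₂ : EuclideanSpace ℝ (Fin 2)} (o : EuclideanSpace ℝ (Fin 2))
    (h₁ : HasStrictDerivAt c₁ v₁ 0) (h₂ : HasStrictDerivAt c₂ v₂ 0)
    (hv : LinearIndependent ℝ ![v₁, v₂]) :
    ∃ Ψ : OpenPartialHomeomorph (ℝ × ℝ) (EuclideanSpace ℝ (Fin 2)), 0 ∈ Ψ.source ∧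
      ∀ a, Ψ a = c₁ a.1 + c₂ a.2 - o := by
  let A : ℝ × ℝ →L[ℝ] EuclideanSpace ℝ (Fin 2) :=
    ((ContinuousLinearMap.fst ℝ ℝ ℝ).smulRight v₁) + ((ContinuousLinearMap.snd ℝ ℝ ℝ).smulRight v₂)
  have hA : HasStrictFDerivAt (fun a : ℝ × ℝ => c₁ a.1 + c₂ a.2 - o) A 0 := by
    refine HasStrictFDerivAt.sub_const o (HasStrictFDerivAt.add ?_ ?_)
    · exact (HasStrictDerivAt.hasStrictFDerivAt h₁).comp (0 : ℝ × ℝ)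
        (ContinuousLinearMap.fst ℝ ℝ ℝ).hasStrictFDerivAt
    · exact (HasStrictDerivAt.hasStrictFDerivAt h₂).comp (0 : ℝ × ℝ)
        (ContinuousLinearMap.snd ℝ ℝ ℝ).hasStrictFDerivAt
  have hinj : Function.Injective A := by
    rw [injective_iff_map_eq_zero]
    rintro ⟨s, t⟩ h
    obtain ⟨rfl, rfl⟩ := (LinearIndependent.pair_iff.1 hv) s t h
    rfl
  let B : (ℝ × ℝ) ≃L[ℝ] EuclideanSpace ℝ (Fin 2) :=
    (LinearEquiv.ofInjectiveOfFinrankEq A.toLinearMap hinj (by simp)).toContinuousLinearEquiv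
  have hB : HasStrictFDerivAt (fun a : ℝ × ℝ => c₁ a.1 + c₂ a.2 - o)
    (B : ℝ × ℝ →L[ℝ] EuclideanSpace ℝ (Fin 2)) 0 := by
    convert hA
    ext <;> rfl
  exact ⟨hB.toOpenPartialHomeomorph _, hB.mem_toOpenPartialHomeomorph_source, fun a => rfl⟩

namespace JohanssonDiagram

variable {S : Type*} [TopologicalSpace S] [ChartedSpace (EuclideanSpace ℝ (Fin 2)) S] {k : ℕ}
  (D : JohanssonDiagram S k)

theorem hasStrictDerivAt_curve (i : Fin (2 * k)) (t : ℝ) {y : S} (hy : D.curve i t = y) :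
    HasStrictDerivAt (fun s => chartAt (EuclideanSpace ℝ (Fin 2)) y (D.curve i (t + s)))
      (D.velocity i t) 0 := by
  subst hy
  have h := D.smooth i t
  have hd : ContDiffAt ℝ ∞ (fun s => chartAt (EuclideanSpace ℝ (Fin 2)) (D.curve i t)
      (D.curve i s)) t := by
    have := (contMDiffAt_iff.1 h).2
    simpa [Function.comp_def] using! this
  have hm := (h.mdifferentiableAt (by simp)).mfderiv
  have hv : D.velocity i t = deriv (fun s => chartAt (EuclideanSpace ℝ (Fin 2)) (D.curve i t)
      (D.curve i s)) t := by
    rw [SisteredCurves.velocity, hm, ← fderiv_apply_one_eq_deriv]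
    simp [writtenInExtChartAt, Function.comp_def]
    rfl
  rw [hv]
  have hs := hd.hasStrictDerivAt (by simp)
  have := HasStrictDerivAt.scomp (0 : ℝ) (h := fun s => t + s) (by simpa using hs)
    ((hasStrictDerivAt_id (0 : ℝ)).const_add t)
  simpa [Function.comp_def] using this


theorem finite_branches (y : S) : (D.branches y).Finite :=
  finite_of_encard_le_coe (D.branches_le_two y)

/-- A chart at `y` in which the branches through `y` are straight. -/
theorem exists_chart (y : S) :
    ∃ Φ : OpenPartialHomeomorph (ℝ × ℝ) S, 0 ∈ Φ.source ∧ Φ 0 = y ∧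
      ∀ b ∈ D.branches y, ∃ v : ℝ × ℝ, ‖v‖ = 1 ∧
        ∀ᶠ s in nhds (0 : ℝ), Φ (s • v) = D.curve b.1 (b.2 + s) := by
  let e := chartAt (EuclideanSpace ℝ (Fin 2)) y
  let c (b : Fin (2 * k) × ℝ) (s : ℝ) := e (D.curve b.1 (b.2 + s))
  have hc : ∀ b ∈ D.branches y, HasStrictDerivAt (c b) (D.velocity b.1 b.2) 0 := fun b hb =>
    D.hasStrictDerivAt_curve b.1 b.2 hb.2
  have hc0 : ∀ b ∈ D.branches y, c b 0 = e y := fun b hb => by simp [c, hb.2]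
  have hline : ∀ v, HasStrictDerivAt (fun s : ℝ => e y + s • v) v 0 := fun v => by
    simpa using ((hasStrictDerivAt_id (0 : ℝ)).smul_const v).const_add (e y)
  have hdim : 1 < Module.finrank ℝ (EuclideanSpace ℝ (Fin 2)) := by simp
  obtain ⟨c₁, c₂, v₁, v₂, h₁, h₂, h₁0, h₂0, hv, hb⟩ : ∃ c₁ c₂ v₁ v₂, HasStrictDerivAt c₁ v₁ 0 ∧
      HasStrictDerivAt c₂ v₂ 0 ∧ c₁ 0 = e y ∧ c₂ 0 = e y ∧ LinearIndependent ℝ ![v₁, v₂] ∧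
      ∀ b ∈ D.branches y, c₁ = c b ∨ c₂ = c b := by
    rcases (D.branches_le_two y).lt_or_eq with h | h
    · have h' : (D.branches y).encard ≤ 1 := by simpa using h
      rcases encard_le_one_iff_eq.1 h' with h | ⟨b, h⟩
      · obtain ⟨v, hv⟩ := exists_ne (0 : EuclideanSpace ℝ (Fin 2))
        obtain ⟨w, hw⟩ := exists_linearIndependent_pair_of_one_lt_finrank hdim hv
        exact ⟨_, _, v, w, hline v, hline w, by simp, by simp, hw, by simp [h]⟩
      · have hb : b ∈ D.branches y := by simp [h]
        obtain ⟨w, hw⟩ := exists_linearIndependent_pair_of_one_lt_finrank hdim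
          (D.immersed b.1 b.2)
        exact ⟨_, _, _, w, hc b hb, hline w, hc0 b hb, by simp, hw, by simp [h]⟩
    · obtain ⟨b, b', hne, h⟩ := encard_eq_two.1 h
      have hb : b ∈ D.branches y := by simp [h]
      have hb' : b' ∈ D.branches y := by simp [h]
      exact ⟨_, _, _, _, hc b hb, hc b' hb', hc0 b hb, hc0 b' hb',
        D.transverse y b hb b' hb' hne, by simp [h]⟩
  obtain ⟨Ψ, hΨ0, hΨ⟩ := exists_openPartialHomeomorph_of_transverse (e y) h₁ h₂ hv
  have hΨe : Ψ 0 = e y := by simp [hΨ, h₁0, h₂0]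
  have hye : y ∈ e.source := mem_chart_source _ y
  have hback : ∀ b ∈ D.branches y,
      ∀ᶠ s in nhds (0 : ℝ), e.symm (c b s) = D.curve b.1 (b.2 + s) := by
    intro b hb
    have hcont : ContinuousAt (fun s => D.curve b.1 (b.2 + s)) 0 :=
      ((D.curve_continuous b.1).comp (by fun_prop)).continuousAt
    filter_upwards [hcont.eventually (e.open_source.mem_nhds (by simpa [hb.2] using hye))] with s hs
    exact e.left_inv hs
  refine ⟨Ψ.trans e.symm, ?_, ?_, fun b hbb => ?_⟩
  · simpa [OpenPartialHomeomorph.trans_source, hΨ0, hΨe] using e.map_source hye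
  · simp [hΨe, e.left_inv hye]
  · rcases hb b hbb with h | h
    · refine ⟨(1, 0), by simp, ?_⟩
      filter_upwards [hback b hbb] with s hs
      simp [hΨ, h₂0, h, hs]
    · refine ⟨(0, 1), by simp, ?_⟩
      filter_upwards [hback b hbb] with s hs
      simp [hΨ, h₁0, h, hs]

theorem exists_mem_branches {i : Fin (2 * k)} {t : ℝ} {y : S} (h : D.curve i t = y) :
    ∃ t' : ℝ, (i, t') ∈ D.branches y ∧ ∀ s, D.curve i (t + s) = D.curve i (t' + s) := by
  have hper : ∀ s, D.curve i (t + s) = D.curve i (toIocMod one_pos 0 t + s) := fun s => by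
    rw [toIocMod, sub_add_eq_add_sub, (D.periodic i).sub_zsmul_eq]
  refine ⟨toIocMod one_pos 0 t, ⟨by simpa using toIocMod_mem_Ioc one_pos 0 t, ?_⟩, hper⟩
  simpa [h] using (hper 0).symm

/-- The ball of radius `ε` in the coordinate system `Φ` at `y` meets the curves only in straight
arcs through `y`. -/
structure IsStraightBall (y : S) (Φ : OpenPartialHomeomorph (ℝ × ℝ) S) (ε : ℝ) : Prop where
  subset_source : Metric.ball 0 ε ⊆ Φ.source
  straight : ∀ i t₀, D.curve i t₀ = y → ∃ v : ℝ × ℝ, ‖v‖ = 1 ∧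
    ∀ s, |s| < ε → Φ (s • v) = D.curve i (t₀ + s)
  exists_param : ∀ i t, D.curve i t ∈ Φ '' Metric.ball 0 ε → ∃ t₀, D.curve i t₀ = y ∧ |t - t₀| < ε

/-- Near `y`, the curves only run close to their branches through `y`. -/
theorem eventually_near_branch [T2Space S] (y : S) {ε : ℝ} (hε : 0 < ε) :
    ∀ᶠ z in nhds y, ∀ i t, D.curve i t = z → ∃ t₀, D.curve i t₀ = y ∧ |t - t₀| < ε := by
  have key : ∀ i, ∀ᶠ z in nhds y, ∀ t ∈ Icc (0 : ℝ) 1, D.curve i t = z →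
      ∃ t₀, D.curve i t₀ = y ∧ |t - t₀| < ε := by
    intro i
    let N : Set ℝ := ⋃ t₀ ∈ {t₀ | D.curve i t₀ = y}, Metric.ball t₀ ε
    have hN : IsOpen N := isOpen_biUnion fun _ _ => Metric.isOpen_ball
    have hK : IsCompact (D.curve i '' (Icc 0 1 \ N)) :=
      (isCompact_Icc.diff hN).image (D.curve_continuous i)
    have hy : y ∉ D.curve i '' (Icc 0 1 \ N) := by
      rintro ⟨t, ht, hty⟩
      exact ht.2 (mem_biUnion (show t ∈ {t₀ | D.curve i t₀ = y} from hty)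
        (Metric.mem_ball_self hε))
    filter_upwards [hK.isClosed.isOpen_compl.mem_nhds hy] with z hz t ht htz
    by_contra! hcon
    refine hz ⟨t, ⟨ht, fun h => ?_⟩, htz⟩
    obtain ⟨t₀, h₀, h⟩ := mem_iUnion₂.1 h
    exact absurd h (not_lt.2 (hcon t₀ h₀))
  filter_upwards [Filter.eventually_all.2 key] with z hz i t ht
  let n := toIocDiv (one_pos : (0 : ℝ) < 1) 0 t
  have hp : ∀ s, D.curve i (s + n) = D.curve i s := fun s => by
    simpa using (D.periodic i).int_mul n s
  obtain ⟨t₀, h₀, h⟩ := hz i (t - n) (Ioc_subset_Icc_self (by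
    simpa [toIocMod, n] using toIocMod_mem_Ioc (one_pos : (0 : ℝ) < 1) 0 t)) (by
      rw [← ht, ← hp (t - n), sub_add_cancel])
  refine ⟨t₀ + n, by rw [hp, h₀], ?_⟩
  rwa [← sub_sub, sub_right_comm]

theorem exists_straight_chart [T2Space S] (y : S) :
    ∃ Φ : OpenPartialHomeomorph (ℝ × ℝ) S, 0 ∈ Φ.source ∧ Φ 0 = y ∧
      ∀ᶠ ε in nhdsWithin (0 : ℝ) (Ioi 0), D.IsStraightBall y Φ ε := by
  obtain ⟨Φ, h0, hy, hΦ⟩ := D.exists_chart y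
  refine ⟨Φ, h0, hy, ?_⟩
  obtain ⟨ε₁, hε₁, hball⟩ := Metric.isOpen_iff.1 Φ.open_source 0 h0
  choose! v hv1 hv using hΦ
  have hv' := (Filter.eventually_all_finite (D.finite_branches y)).2 hv
  obtain ⟨ε₂, hε₂, hstr⟩ := Metric.eventually_nhds_iff.1 hv'
  have hstr' : ∀ i t₀, D.curve i t₀ = y → ∃ v : ℝ × ℝ, ‖v‖ = 1 ∧
      ∀ s, |s| < ε₂ → Φ (s • v) = D.curve i (t₀ + s) := by
    intro i t₀ h
    obtain ⟨t', hb, ht'⟩ := D.exists_mem_branches h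
    refine ⟨v (i, t'), hv1 _ hb, fun s hs => ?_⟩
    rw [ht', hstr (by simpa using hs) _ hb]
  have hnear : ∀ᶠ a in nhds (0 : ℝ × ℝ), ∀ i t, D.curve i t = Φ a →
      ∃ t₀, D.curve i t₀ = y ∧ |t - t₀| < min ε₁ ε₂ := by
    have := D.eventually_near_branch y (lt_min hε₁ hε₂)
    rw [← hy] at this
    simpa only [hy] using (Φ.continuousAt h0).eventually this
  obtain ⟨ε₃, hε₃, hnear⟩ := Metric.eventually_nhds_iff.1 hnear
  have hpos : 0 < min (min ε₁ ε₂) ε₃ := lt_min (lt_min hε₁ hε₂) hε₃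
  filter_upwards [Ioo_mem_nhdsGT hpos] with ε hε
  have hε₁' : ε ≤ ε₁ := (hε.2.le.trans (min_le_left _ _)).trans (min_le_left _ _)
  have hε₂' : ε ≤ ε₂ := (hε.2.le.trans (min_le_left _ _)).trans (min_le_right _ _)
  have hε₃' : ε ≤ ε₃ := hε.2.le.trans (min_le_right _ _)
  refine ⟨(Metric.ball_subset_ball hε₁').trans hball, fun i t₀ h => ?_, ?_⟩
  · obtain ⟨w, hw, h'⟩ := hstr' i t₀ h
    exact ⟨w, hw, fun s hs => h' s (hs.trans_le hε₂')⟩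
  · rintro i t ⟨a, ha, hat⟩
    have ha' : dist a 0 < ε := ha
    obtain ⟨t₀, h₀, ht⟩ := hnear (ha'.trans_le hε₃') i t hat.symm
    refine ⟨t₀, h₀, ?_⟩
    obtain ⟨w, hw, h'⟩ := hstr' i t₀ h₀
    have h1 := h' (t - t₀) (ht.trans_le (min_le_right _ _))
    rw [add_sub_cancel, ← hat] at h1
    have hn : ‖(t - t₀) • w‖ = |t - t₀| := by rw [norm_smul, hw, mul_one, Real.norm_eq_abs]
    have h2 : (t - t₀) • w = a := Φ.injOn (hball (by
      rw [mem_ball_zero_iff, hn]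
      exact ht.trans_le (min_le_left _ _))) (hball (ha'.trans_le hε₁')) h1
    rw [← hn, h2]
    simpa using ha'

end JohanssonDiagram

/-! ### Contractible neighbourhoods in the quotient -/

theorem OpenPartialHomeomorph.eventually_image_ball_subset {S : Type*} [TopologicalSpace S]
    {Φ : OpenPartialHomeomorph (ℝ × ℝ) S} (h0 : 0 ∈ Φ.source) {N : Set S} (hN : N ∈ nhds (Φ 0)) :
    ∀ᶠ ε in nhdsWithin (0 : ℝ) (Ioi 0), Φ '' Metric.ball 0 ε ⊆ N := by
  obtain ⟨δ, hδ, h⟩ := Metric.mem_nhds_iff.1 ((Φ.continuousAt h0).preimage_mem_nhds hN)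
  filter_upwards [Ioo_mem_nhdsGT hδ] with ε hε
  exact image_subset_iff.2 ((Metric.ball_subset_ball hε.2.le).trans h)

namespace JohanssonDiagram

variable {S : Type*} [TopologicalSpace S] [ChartedSpace (EuclideanSpace ℝ (Fin 2)) S] {k : ℕ}
  {D : JohanssonDiagram S k} {X : Type*} [TopologicalSpace X]

theorem exists_localContraction [T2Space S] {f : C(S, X)} (hq : Topology.IsQuotientMap f)
    (hf : ∀ {y y'}, f y = f y' ↔ D.related y y') (hfin : ∀ P, (f ⁻¹' {P}).Finite) (P : X)
    (N : Set X) (hN : N ∈ nhds P) : ∃ C : D.LocalContraction f P, C.U ⊆ N := by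
  have hcurve : ∀ i t, f (D.curve i t) = f (D.curve (D.sister i) t) := fun i t =>
    hf.2 (D.related_curve i t)
  let Q := f ⁻¹' {P}
  choose Φ h0 hΦ hgood using D.exists_straight_chart
  obtain ⟨O, hO, hdisj⟩ := (hfin P).t2_separation
  have hev : ∀ᶠ ε in nhdsWithin (0 : ℝ) (Ioi 0), ∀ y ∈ Q, D.IsStraightBall y (Φ y) ε ∧
      Φ y '' Metric.ball 0 ε ⊆ O y ∩ f ⁻¹' N := by
    refine (Filter.eventually_all_finite (hfin P)).2 fun y hy => (hgood y).and ?_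
    refine OpenPartialHomeomorph.eventually_image_ball_subset (h0 y) ?_
    rw [hΦ]
    refine Filter.inter_mem ((hO y).2.mem_nhds (hO y).1)
      (f.continuous.continuousAt.preimage_mem_nhds ?_)
    rwa [show f y = P from hy]
  obtain ⟨ε, hε, hε0⟩ := (hev.and self_mem_nhdsWithin).exists
  replace hε0 : 0 < ε := hε0
  let V (y : S) : Set S := Φ y '' Metric.ball 0 ε
  have hVO : ∀ y ∈ Q, V y ⊆ O y := fun y hy => (hε y hy).2.trans inter_subset_left
  have hVopen : ∀ y ∈ Q, IsOpen (V y) := fun y hy =>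
    (Φ y).isOpen_image_of_subset_source Metric.isOpen_ball (hε y hy).1.subset_source
  have hVuniq : ∀ y ∈ Q, ∀ y' ∈ Q, ∀ z, z ∈ V y → z ∈ V y' → y = y' := by
    intro y hy y' hy' z hz hz'
    by_contra hne
    exact disjoint_left.1 (hdisj hy hy' hne) (hVO y hy hz) (hVO y' hy' hz')
  let B : Set S := ⋃ y ∈ Q, V y
  have hBopen : IsOpen B := isOpen_biUnion hVopen
  let sc (y z : S) (r : I) : S := Φ y ((r : ℝ) • (Φ y).symm z)
  have hsymm : ∀ y ∈ Q, ∀ z ∈ V y, (Φ y).symm z ∈ Metric.ball (0 : ℝ × ℝ) ε := by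
    rintro y hy _ ⟨a, ha, rfl⟩
    rwa [(Φ y).left_inv ((hε y hy).1.subset_source ha)]
  have hball : ∀ y ∈ Q, ∀ z ∈ V y, ∀ r : I,
      (r : ℝ) • (Φ y).symm z ∈ Metric.ball (0 : ℝ × ℝ) ε := by
    intro y hy z hz r
    have := hsymm y hy z hz
    rw [mem_ball_zero_iff] at this ⊢
    rw [norm_smul, Real.norm_of_nonneg r.2.1]
    exact (mul_le_of_le_one_left (norm_nonneg _) r.2.2).trans_lt this
  have hsymmV : ∀ y ∈ Q, V y ⊆ (Φ y).target := by
    rintro y hy _ ⟨a, ha, rfl⟩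
    exact (Φ y).map_source ((hε y hy).1.subset_source ha)
  have hsc : ∀ y ∈ Q, ContinuousOn (Function.uncurry (sc y)) (V y ×ˢ univ) := by
    intro y hy
    refine (Φ y).continuousOn.comp (f := fun a : S × I => (a.2 : ℝ) • (Φ y).symm a.1) ?_ ?_
    · refine ContinuousOn.smul (continuous_subtype_val.comp continuous_snd).continuousOn ?_
      exact (Φ y).continuousOn_symm.comp continuousOn_fst fun a ha => hsymmV y hy ha.1
    · exact fun a ha => (hε y hy).1.subset_source (hball y hy a.1 ha.1 a.2)
  classical
  let h (z : S) (r : I) : S := if hz : ∃ y ∈ Q, z ∈ V y then sc hz.choose z r else z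
  have hh : ∀ y ∈ Q, ∀ z ∈ V y, ∀ r, h z r = sc y z r := by
    intro y hy z hz r
    have hex : ∃ y ∈ Q, z ∈ V y := ⟨y, hy, hz⟩
    have : hex.choose = y := hVuniq _ hex.choose_spec.1 _ hy z hex.choose_spec.2 hz
    simp only [h, dif_pos hex, this]
  have harc : ∀ i t₀ t, D.curve i t₀ ∈ Q → |t - t₀| < ε →
      D.curve i t ∈ V (D.curve i t₀) ∧
        ∀ r : I, h (D.curve i t) r = D.curve i (t₀ + r * (t - t₀)) := by
    intro i t₀ t hy ht
    obtain ⟨v, hv, hs⟩ := (hε _ hy).1.straight i t₀ rfl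
    have hmem : (t - t₀) • v ∈ Metric.ball (0 : ℝ × ℝ) ε := by
      rwa [mem_ball_zero_iff, norm_smul, hv, mul_one]
    have ht' : Φ (D.curve i t₀) ((t - t₀) • v) = D.curve i t := by
      rw [hs _ ht, add_sub_cancel]
    have hV : D.curve i t ∈ V (D.curve i t₀) := ⟨_, hmem, ht'⟩
    refine ⟨hV, fun r => ?_⟩
    rw [hh _ hy _ hV]
    simp only [sc]
    rw [← ht', (Φ _).left_inv ((hε _ hy).1.subset_source hmem), smul_smul, hs]
    rw [abs_mul, abs_of_nonneg r.2.1]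
    exact (mul_le_of_le_one_left (abs_nonneg _) r.2.2).trans_lt ht
  have hparam : ∀ i t, D.curve i t ∈ B → ∃ t₀, D.curve i t₀ ∈ Q ∧
      D.curve (D.sister i) t₀ ∈ Q ∧ |t - t₀| < ε := by
    intro i t ht
    obtain ⟨y, hy, hz⟩ := mem_iUnion₂.1 ht
    obtain ⟨t₀, h₀, ht₀⟩ := (hε y hy).1.exists_param i t hz
    refine ⟨t₀, by rwa [h₀], ?_, ht₀⟩
    change f _ = P
    rw [← hcurve, h₀]
    exact hy
  have hsister : ∀ i t, D.curve i t ∈ B → D.curve (D.sister i) t ∈ B := by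
    intro i t ht
    obtain ⟨t₀, -, h₀, ht₀⟩ := hparam i t ht
    exact mem_iUnion₂.2 ⟨_, h₀, (harc _ t₀ t h₀ ht₀).1⟩
  have hsat : ∀ {z z'}, D.related z z' → (z ∈ B ↔ z' ∈ B) :=
    D.mem_iff_of_related hsister
  have hpre : f ⁻¹' (f '' B) = B := by
    refine Subset.antisymm ?_ (subset_preimage_image f B)
    rintro z ⟨w, hw, hwz⟩
    exact (hsat (hf.1 hwz)).1 hw
  have hmemB : ∀ {z}, f z ∈ f '' B ↔ z ∈ B := fun {z} => by
    rw [← mem_preimage, hpre]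
  have hhV : ∀ y ∈ Q, ∀ z ∈ V y, ∀ r, h z r ∈ V y := fun y hy z hz r => by
    rw [hh y hy z hz]
    exact ⟨_, hball y hy z hz r, rfl⟩
  refine ⟨⟨f '' B, ?_, ?_, h, ?_, ?_, ?_, ?_, ?_⟩, ?_⟩
  · rw [← hq.isOpen_preimage, hpre]
    exact hBopen
  · obtain ⟨y, rfl⟩ := hq.surjective P
    refine ⟨y, mem_iUnion₂.2 ⟨y, rfl, 0, Metric.mem_ball_self hε0, hΦ y⟩, rfl⟩
  · rw [hpre]
    rintro ⟨z, r⟩ ⟨hz, -⟩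
    obtain ⟨y, hy, hz⟩ := mem_iUnion₂.1 hz
    have hnh : V y ×ˢ (univ : Set I) ∈ nhds (z, r) :=
      ((hVopen y hy).prod isOpen_univ).mem_nhds ⟨hz, trivial⟩
    refine (((hsc y hy).continuousAt hnh).congr ?_).continuousWithinAt
    filter_upwards [hnh] with a ha
    exact (hh y hy a.1 ha.1 a.2).symm
  · intro z r hz
    obtain ⟨y, hy, hz⟩ := mem_iUnion₂.1 (hmemB.1 hz)
    exact hmemB.2 (mem_iUnion₂.2 ⟨y, hy, hhV y hy z hz r⟩)
  · intro z hz
    obtain ⟨y, hy, hz⟩ := mem_iUnion₂.1 (hmemB.1 hz)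
    rw [hh y hy z hz]
    simp [sc, (Φ y).right_inv (hsymmV y hy hz)]
  · intro z hz
    obtain ⟨y, hy, hz⟩ := mem_iUnion₂.1 (hmemB.1 hz)
    rw [hh y hy z hz]
    simpa [sc, hΦ] using! hy
  · intro i t ht
    obtain ⟨t₀, h₁, h₂, ht₀⟩ := hparam i t (hmemB.1 ht)
    refine ⟨t₀, ?_⟩
    rintro i' (rfl | rfl)
    · exact (harc _ t₀ t h₁ ht₀).2
    · exact (harc _ t₀ t h₂ ht₀).2
  · rintro _ ⟨z, hz, rfl⟩
    obtain ⟨y, hy, hz⟩ := mem_iUnion₂.1 hz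
    exact ((hε y hy).2 hz).2

end JohanssonDiagram

/-! ### The classes of the relation defined by a diagram -/

theorem Set.eq_pair_of_encard_eq_two {α : Type*} {s : Set α} (hs : s.encard = 2) {a b : α}
    (ha : a ∈ s) (hb : b ∈ s) (hab : a ≠ b) : s = {a, b} := by
  refine (Finite.eq_of_subset_of_encard_le (toFinite _) (pair_subset ha hb) ?_).symm
  rw [hs, encard_pair hab]

theorem Set.ne_of_encard_eq_three {α : Type*} {a b c : α}
    (h : ({a, b, c} : Set α).encard = 3) : a ≠ b ∧ b ≠ c ∧ a ≠ c := by
  have hle : ∀ a b : α, ({a, b} : Set α).encard ≠ 3 := fun a b h => by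
    have := encard_insert_le {b} a
    rw [h, encard_singleton] at this
    exact absurd this (by decide)
  refine ⟨?_, ?_, ?_⟩ <;> rintro rfl
  · exact hle a c (by simpa using h)
  · exact hle a b (by simpa using h)
  · exact hle b a (by simpa [insert_comm a b] using h)

namespace JohanssonDiagram

variable {S : Type*} [TopologicalSpace S] [ChartedSpace (EuclideanSpace ℝ (Fin 2)) S] {k : ℕ}
  (D : JohanssonDiagram S k)

theorem eq_of_related_of_branches_eq_empty {y z : S} (hy : D.branches y = ∅)
    (h : D.related y z) : z = y := by
  refine (D.mem_iff_of_related (A := {y}) (fun i t ht => ?_) h).1 rfl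
  obtain ⟨t', hb, -⟩ := D.exists_mem_branches ht
  simp [hy] at hb

theorem setOf_related_congr {y z : S} (h : D.related y z) :
    {Q | D.related y Q} = {Q | D.related z Q} :=
  ext fun _ => ⟨fun h' => D.related.trans (D.related.symm h) h', fun h' => D.related.trans h h'⟩

theorem encard_branches_cases (y : S) :
    (D.branches y = ∅ ∧ {Q | D.related y Q}.encard = 1) ∨
    ((D.branches y).encard = 1 ∧ {Q | D.related y Q}.encard = 2) ∨
    ((D.branches y).encard = 2 ∧ {Q | D.related y Q}.encard = 3) := by
  rcases (D.branches_le_two y).lt_or_eq with h | h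
  · have h1 : (D.branches y).encard ≤ 1 := by simpa using h
    rcases h1.lt_or_eq with h | h
    · have h0 : D.branches y = ∅ := by simpa using h
      refine .inl ⟨h0, encard_eq_one.2 ⟨y, ?_⟩⟩
      ext z
      exact ⟨D.eq_of_related_of_branches_eq_empty h0, fun h => h ▸ D.related.refl y⟩
    · exact .inr (.inl ⟨h, D.pairs y h⟩)
  · exact .inr (.inr ⟨h, D.triplets y h⟩)

theorem finite_setOf_related (y : S) : {Q | D.related y Q}.Finite := by
  rw [← encard_ne_top_iff]
  rcases D.encard_branches_cases y with ⟨-, h⟩ | ⟨-, h⟩ | ⟨-, h⟩ <;> rw [h] <;> decide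

theorem encard_branches_eq_of_related {y z : S} (h : D.related y z) :
    (D.branches y).encard = (D.branches z).encard := by
  have hc := congrArg encard (D.setOf_related_congr h)
  rcases D.encard_branches_cases y with ⟨h₁, h₁'⟩ | ⟨h₁, h₁'⟩ | ⟨h₁, h₁'⟩ <;>
  rcases D.encard_branches_cases z with ⟨h₂, h₂'⟩ | ⟨h₂, h₂'⟩ | ⟨h₂, h₂'⟩ <;>
  rw [h₁', h₂'] at hc <;> first | exact absurd hc (by decide) | simp [h₁, h₂]

/-- A family of jumps between sister points that is compatible at the triple points is the
coboundary of a function on each class. -/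
theorem exists_potential_on_class {G : Type*} [Group G] (J : Fin (2 * k) → ℝ → G)
    (hJs : ∀ i t, J (D.sister i) t = (J i t)⁻¹) {x : S} (L : ∀ P, D.TripletLabelling x P)
    (hJt : ∀ P, J (L P).α (L P).u * J (L P).β (L P).v * J (L P).γ (L P).w = 1) (y : S) :
    ∃ j : S → G, ∀ z, D.related y z → ∀ b ∈ D.branches z,
      J b.1 b.2 = (j z)⁻¹ * j (D.curve (D.sister b.1) b.2) := by
  classical
  rcases D.encard_branches_cases y with ⟨h, -⟩ | ⟨h, h'⟩ | ⟨h, h'⟩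
  · refine ⟨1, fun z hz b hb => ?_⟩
    rw [D.eq_of_related_of_branches_eq_empty h hz, h] at hb
    exact hb.elim
  · obtain ⟨⟨i, t⟩, hb⟩ := encard_eq_one.1 h
    have hit : (i, t) ∈ D.branches y := by simp [hb]
    have hy : D.curve i t = y := hit.2
    let y' := D.curve (D.sister i) t
    have hyy' : D.related y y' := hy ▸ D.related_curve i t
    have hne : y ≠ y' := by
      intro hyy
      have : (D.sister i, t) ∈ D.branches y := ⟨hit.1, hyy.symm⟩
      rw [hb] at this
      exact D.sister_ne i (congrArg Prod.fst this)
    have hcl := eq_pair_of_encard_eq_two h' (D.related.refl y) hyy' hne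
    have hb' : D.branches y' = {(D.sister i, t)} := by
      obtain ⟨b', hb'⟩ := encard_eq_one.1 ((D.encard_branches_eq_of_related hyy').symm.trans h)
      have : (D.sister i, t) ∈ D.branches y' := ⟨hit.1, rfl⟩
      rw [hb'] at this ⊢
      rw [this]
    refine ⟨fun z => if z = y then 1 else J i t, fun z hz b hbz => ?_⟩
    have hz' : z ∈ ({y, y'} : Set S) := hcl ▸ hz
    rcases hz' with rfl | rfl
    · rw [hb] at hbz
      obtain rfl : b = (i, t) := hbz
      simp [hne.symm, y']
    · rw [hb'] at hbz
      obtain rfl : b = (D.sister i, t) := hbz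
      simp [hne.symm, hJs, D.sister_sister, hy]
  · have hPset : {Q | D.proj Q = D.proj y} = {Q | D.related y Q} := by
      ext Q
      exact Quotient.eq.trans ⟨D.related.symm, D.related.symm⟩
    let P : D.TriplePoint := ⟨D.proj y, by rw [hPset, h']⟩
    have hJ := hJt P
    obtain ⟨L', hL'⟩ : ∃ L', L' = L P := ⟨_, rfl⟩
    rw [← hL'] at hJ
    clear hL'
    obtain ⟨α, β, γ, u, v, w, P₁, P₂, P₃, htr, hu, hv, hw, hα, hα', hβ, hβ', hγ, hγ', _, _, _⟩ := L'
    have htr' : ({P₁, P₂, P₃} : Set S) = {Q | D.related y Q} := htr.trans hPset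
    obtain ⟨h₁₂, h₂₃, h₁₃⟩ := ne_of_encard_eq_three (htr'.symm ▸ h')
    have hbr : ∀ z ∈ ({P₁, P₂, P₃} : Set S), (D.branches z).encard = 2 := fun z hz =>
      (D.encard_branches_eq_of_related (show D.related y z by rwa [htr'] at hz)).symm.trans h
    have hne : ∀ {i i' : Fin (2 * k)} {t t' : ℝ},
        D.curve (D.sister i) t ≠ D.curve (D.sister i') t' → (i, t) ≠ (i', t') := by
      rintro i i' t t' h h'
      obtain ⟨rfl, rfl⟩ := Prod.mk.inj h'
      exact h rfl
    have hb₁ := eq_pair_of_encard_eq_two (hbr P₁ (by simp)) (a := (α, u)) (b := (D.sister γ, w))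
      ⟨hu, hα⟩ ⟨hw, hγ'⟩ (hne (by rwa [D.sister_sister, hα', hγ]))
    have hb₂ := eq_pair_of_encard_eq_two (hbr P₂ (by simp)) (a := (β, v)) (b := (D.sister α, u))
      ⟨hv, hβ⟩ ⟨hu, hα'⟩ (hne (by rw [D.sister_sister, hβ', hα]; exact h₁₃.symm))
    have hb₃ := eq_pair_of_encard_eq_two (hbr P₃ (by simp)) (a := (γ, w)) (b := (D.sister β, v))
      ⟨hw, hγ⟩ ⟨hv, hβ'⟩ (hne (by rwa [D.sister_sister, hγ', hβ]))
    replace hJ : J α u * J β v * J γ w = 1 := hJ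
    refine ⟨fun z => if z = P₁ then 1 else if z = P₂ then J α u else J α u * J β v,
      fun z hz b hbz => ?_⟩
    have hz' : z ∈ ({P₁, P₂, P₃} : Set S) := htr'.symm ▸ hz
    rcases hz' with rfl | rfl | rfl
    · rw [hb₁] at hbz
      rcases hbz with rfl | rfl
      · simp [hα', h₁₂.symm]
      · simpa [hJs, D.sister_sister, hγ, h₁₃.symm, h₂₃.symm] using
          (eq_inv_of_mul_eq_one_left hJ).symm
    · rw [hb₂] at hbz
      rcases hbz with rfl | rfl
      · simp [hβ', h₁₂.symm, h₁₃.symm, h₂₃.symm]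
      · simp [hJs, D.sister_sister, hα, h₁₂.symm]
    · rw [hb₃] at hbz
      rcases hbz with rfl | rfl
      · simpa [hγ', h₁₃.symm, h₂₃.symm] using eq_inv_of_mul_eq_one_right hJ
      · simp [hJs, D.sister_sister, hβ, h₁₂.symm, h₁₃.symm, h₂₃.symm]

/-- A periodic family of jumps between sister points that is compatible at the triple points is a
coboundary. -/
theorem exists_potential {G : Type*} [Group G] (J : Fin (2 * k) → ℝ → G)
    (hJs : ∀ i t, J (D.sister i) t = (J i t)⁻¹) (hJp : ∀ i, Function.Periodic (J i) 1)
    {x : S} (L : ∀ P, D.TripletLabelling x P)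
    (hJt : ∀ P, J (L P).α (L P).u * J (L P).β (L P).v * J (L P).γ (L P).w = 1) :
    ∃ j : S → G, j x = 1 ∧
      ∀ i t, J i t = (j (D.curve i t))⁻¹ * j (D.curve (D.sister i) t) := by
  choose j hj using D.exists_potential_on_class J hJs L hJt
  let r (z : S) : S := (D.proj z).out
  have hr : ∀ z, D.related (r z) z := fun z => Quotient.exact (Quotient.out_eq (D.proj z))
  refine ⟨fun z => (j (r x) x)⁻¹ * j (r z) z, by simp, fun i t => ?_⟩
  have hrr : r (D.curve (D.sister i) t) = r (D.curve i t) :=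
    congrArg Quotient.out (D.proj_curve i t).symm
  let t' := toIocMod (one_pos : (0 : ℝ) < 1) 0 t
  have hJ : J i t = J i t' := ((hJp i).sub_zsmul_eq _).symm
  have hc : ∀ i, D.curve i t = D.curve i t' := fun i => ((D.periodic i).sub_zsmul_eq _).symm
  have hmem : (i, t') ∈ D.branches (D.curve i t) :=
    ⟨by simpa using toIocMod_mem_Ioc one_pos 0 t, (hc i).symm⟩
  have key := hj (r (D.curve i t)) (D.curve i t) (hr _) _ hmem
  simp only [← hc (D.sister i)] at key
  simp only [hJ, hrr, key]
  group

end JohanssonDiagram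

/-! ### Trivial jumps after a change of gauge -/

namespace JohanssonDiagram

variable {S : Type*} [TopologicalSpace S] [ChartedSpace (EuclideanSpace ℝ (Fin 2)) S] {k : ℕ}
  (D : JohanssonDiagram S k) {G : Type*} [Group G] (W : PathRep S G)

theorem map_arc_mul (i : Fin (2 * k)) (t t' t'' : ℝ) :
    W (D.arc i t t') * W (D.arc i t' t'') = W (D.arc i t t'') := by
  let ℓ (a b : ℝ) : Path a b := ⟨⟨fun r => a + r * (b - a), by fun_prop⟩, by simp, by simp⟩
  have h : ∀ a b, W (D.arc i a b) = W ((ℓ a b).map (D.curve_continuous i)) := fun a b =>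
    W.map_congr fun _ => rfl
  rw [h, h, h, ← W.map_trans, ← Path.map_trans]
  exact W.map_eq_of_simplyConnected ⟨_, D.curve_continuous i⟩ _ _

theorem map_arc_add_one (i : Fin (2 * k)) (t t' : ℝ) :
    W (D.arc i (t + 1) (t' + 1)) = W (D.arc i t t') := by
  refine W.map_congr fun r => ?_
  change D.curve i _ = D.curve i _
  rw [← D.periodic i (t + r * (t' - t))]
  congr 1
  ring

theorem map_loop (i : Fin (2 * k)) : W (D.loop i) = W (D.arc i 0 1) :=
  W.map_congr fun r => by simp [loop, arc]

theorem map_tail (i : Fin (2 * k)) (u : ℝ) {P : S} (h : D.curve i u = P) :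
    W (D.tail i u h) = W (D.arc i u 1) :=
  W.map_congr fun _ => rfl

/-- If group elements `a i` satisfy the dual loop, double curve and triple point relations with
respect to a representation of the paths of `S`, then after a change of gauge the representation
takes the same values on sister arcs, and `a i` becomes the value of the dual loop. -/
theorem exists_gauge {x : S} (lam : ∀ i, Path x (D.curve i 0)) (L : ∀ P, D.TripletLabelling x P)
    (a : Fin (2 * k) → G) (h1 : ∀ i, a (D.sister i) * a i = 1)
    (h3 : ∀ i, W (lam i) * W (D.loop i) * (W (lam i))⁻¹ =
      a i * (W (lam (D.sister i)) * W (D.loop (D.sister i)) * (W (lam (D.sister i)))⁻¹) * (a i)⁻¹)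
    (h2 : ∀ P,
      (W (L P).q₁ * W (D.tail _ _ (L P).hα) * (W (lam (L P).α))⁻¹ * a (L P).α *
        (W (L P).q₂ * W (D.tail _ _ (L P).hα') * (W (lam (D.sister (L P).α)))⁻¹)⁻¹) *
      (W (L P).q₂ * W (D.tail _ _ (L P).hβ) * (W (lam (L P).β))⁻¹ * a (L P).β *
        (W (L P).q₃ * W (D.tail _ _ (L P).hβ') * (W (lam (D.sister (L P).β)))⁻¹)⁻¹) *
      (W (L P).q₃ * W (D.tail _ _ (L P).hγ) * (W (lam (L P).γ))⁻¹ * a (L P).γ *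
        (W (L P).q₁ * W (D.tail _ _ (L P).hγ') * (W (lam (D.sister (L P).γ)))⁻¹)⁻¹) = 1) :
    ∃ j : S → G, j x = 1 ∧
      (∀ i t t', W.gauge j (D.arc i t t') = W.gauge j (D.arc (D.sister i) t t')) ∧
      ∀ i, W.gauge j (lam i) * (W.gauge j (lam (D.sister i)))⁻¹ = a i := by
  let A (i : Fin (2 * k)) : G := (W (lam i))⁻¹ * a i * W (lam (D.sister i))
  let J (i : Fin (2 * k)) (t : ℝ) : G := (W (D.arc i 0 t))⁻¹ * A i * W (D.arc (D.sister i) 0 t)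
  have hlam : ∀ i i', i = i' → W (lam i) = W (lam i') := by rintro i _ rfl; rfl
  have harc : ∀ i i' t t', i = i' → W (D.arc i t t') = W (D.arc i' t t') := by
    rintro i _ t t' rfl; rfl
  have hAs : ∀ i, A (D.sister i) = (A i)⁻¹ := fun i => by
    simp only [A, hlam _ _ (D.sister_sister i), eq_inv_of_mul_eq_one_left (h1 i)]
    group
  have hA3 : ∀ i, W (D.arc i 0 1) * A i = A i * W (D.arc (D.sister i) 0 1) := fun i => by
    have := h3 i
    simp only [map_loop] at this
    calc W (D.arc i 0 1) * A i = (W (lam i))⁻¹ * (W (lam i) * W (D.arc i 0 1) * (W (lam i))⁻¹) *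
          (a i * W (lam (D.sister i))) := by simp only [A]; group
      _ = A i * W (D.arc (D.sister i) 0 1) := by rw [this]; simp only [A]; group
  have hJadd : ∀ i t t', J i t' =
      (W (D.arc i t t'))⁻¹ * J i t * W (D.arc (D.sister i) t t') := fun i t t' => by
    simp only [J, ← D.map_arc_mul W _ 0 t t']
    group
  have hJ1 : ∀ i, J i 1 = A i := fun i => by
    simp only [J]
    rw [mul_assoc, ← hA3, inv_mul_cancel_left]
  have hJ0 : ∀ i, J i 0 = A i := fun i => by
    have : ∀ i, W (D.arc i 0 0) = 1 := fun i => W.map_const fun r => by simp [arc]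
    simp [J, this]
  have hJp : ∀ i, Function.Periodic (J i) 1 := fun i t => by
    have e : ∀ i, W (D.arc i 1 (t + 1)) = W (D.arc i 0 t) := fun i => by
      rw [← D.map_arc_add_one W i 0 t]
      exact W.map_congr fun r => by simp [arc]
    rw [hJadd i 1 (t + 1), hJ1, e, e]
  have hJtail : ∀ i u, J i u = W (D.arc i u 1) * A i * (W (D.arc (D.sister i) u 1))⁻¹ :=
    fun i u => by
      rw [← hJ1, hJadd i u 1]
      group
  have hJs : ∀ i t, J (D.sister i) t = (J i t)⁻¹ := fun i t => by
    simp only [J, hAs, harc _ _ _ _ (D.sister_sister i)]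
    group
  have hJt : ∀ P, J (L P).α (L P).u * J (L P).β (L P).v * J (L P).γ (L P).w = 1 := fun P => by
    have := h2 P
    simp only [map_tail] at this
    rw [hJtail, hJtail, hJtail, ← conj_eq_one_iff (a := W (L P).q₁), ← this]
    simp only [A]
    group
  obtain ⟨j, hjx, hj⟩ := D.exists_potential J hJs hJp L hJt
  refine ⟨j, hjx, fun i t t' => ?_, fun i => ?_⟩
  · have := hJadd i t t'
    rw [hj, hj] at this
    simp only [PathRep.gauge_apply]
    calc j (D.curve i t) * W (D.arc i t t') * (j (D.curve i t'))⁻¹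
        = j (D.curve i t) * W (D.arc i t t') * ((j (D.curve i t'))⁻¹ *
          j (D.curve (D.sister i) t')) * (j (D.curve (D.sister i) t'))⁻¹ := by group
      _ = _ := by rw [this]; group
  · have := hJ0 i
    rw [hj] at this
    have ha : a i = W (lam i) * A i * (W (lam (D.sister i)))⁻¹ := by simp only [A]; group
    rw [ha, ← this]
    simp only [PathRep.gauge_apply, hjx]
    group

end JohanssonDiagram

/-! ### The presentation -/

namespace JohanssonDiagram

variable {S : Type*} [TopologicalSpace S] [ChartedSpace (EuclideanSpace ℝ (Fin 2)) S] {k : ℕ}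
  {D : JohanssonDiagram S k} {g : ℕ} {x : S} (c : D.Choices g x)

namespace Choices

/-- The class of a word in the presented group. -/
def mkGroup : FreeGroup (Fin (2 * g) ⊕ Fin (2 * k)) →* c.group := PresentedGroup.mk c.relators

theorem mkGroup_eq_one {r : FreeGroup (Fin (2 * g) ⊕ Fin (2 * k))} (hr : r ∈ c.relators) :
    c.mkGroup r = 1 :=
  PresentedGroup.one_of_mem hr

/-- The homomorphism from the fundamental group of the surface to the presented group. -/
theorem exists_surfaceHom : ∃ φ : Pi1 S x →* c.group,
    (∀ w : FreeGroup (Fin (2 * g)),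
      φ (FreeGroup.lift c.s w) = c.mkGroup (FreeGroup.map Sum.inl w)) ∧
    ∀ p : Path x x, φ (Pi1.ofPath p) = c.mkGroup (c.surfaceWord p) := by
  let F : FreeGroup (Fin (2 * g)) →* c.group := c.mkGroup.comp (FreeGroup.map Sum.inl)
  have hker : (FreeGroup.lift c.s).ker ≤ F.ker := by
    rw [← c.normalClosure_surfaceRel]
    refine Subgroup.normalClosure_le_normal fun r hr => ?_
    exact c.mkGroup_eq_one (.inr ⟨r, hr, rfl⟩)
  have hsurj : Function.Surjective (FreeGroup.lift c.s) := fun d => ⟨_, c.lift_word d⟩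
  let φ := (FreeGroup.lift c.s).liftOfSurjective hsurj ⟨F, hker⟩
  have hφ : ∀ w, φ (FreeGroup.lift c.s w) = F w := fun w =>
    (FreeGroup.lift c.s).liftOfRightInverse_comp_apply _ _ ⟨F, hker⟩ w
  refine ⟨φ, hφ, fun p => ?_⟩
  rw [← c.lift_word (Pi1.ofPath p), hφ]
  rfl

variable {X : Type*} [TopologicalSpace X] (f : C(S, X))
  (hf : ∀ i t, f (D.curve i t) = f (D.curve (D.sister i) t))

/-- The images of the generators. -/
def genImage : Fin (2 * g) ⊕ Fin (2 * k) → Pi1 X (f x) :=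
  Sum.elim (fun i => Pi1.map f x (c.s i)) fun i => Pi1.ofPath (c.dualLoop f hf i)

theorem lift_genImage_inl (w : FreeGroup (Fin (2 * g))) :
    FreeGroup.lift (c.genImage f hf) (FreeGroup.map Sum.inl w) =
      Pi1.map f x (FreeGroup.lift c.s w) := by
  have : (FreeGroup.lift (c.genImage f hf)).comp (FreeGroup.map Sum.inl) =
      (Pi1.map f x).comp (FreeGroup.lift c.s) := by
    ext i
    simp [genImage]
  exact DFunLike.congr_fun this w

theorem lift_genImage_surfaceWord (p : Path x x) :
    FreeGroup.lift (c.genImage f hf) (c.surfaceWord p) = Pi1.ofPath (p.map f.continuous) := by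
  rw [surfaceWord, lift_genImage_inl, c.lift_word, Pi1.map_ofPath]

variable {f} (N : PathRep X (Pi1 X (f x))) (hN : ∀ p : Path (f x) (f x), N p = Pi1.ofPath p)

include hN in
theorem lift_genImage_a (i : Fin (2 * k)) :
    FreeGroup.lift (c.genImage f hf) (a i) =
      N ((c.lam i).map f.continuous) * (N ((c.lam (D.sister i)).map f.continuous))⁻¹ := by
  simp only [a, FreeGroup.lift_apply_of, genImage, Sum.elim_inr]
  rw [← hN, dualLoop, N.map_trans, N.map_cast, N.map_symm]

include hN in
theorem lift_genImage_relators {r : FreeGroup (Fin (2 * g) ⊕ Fin (2 * k))} (hr : r ∈ c.relators) :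
    FreeGroup.lift (c.genImage f hf) r = 1 := by
  have hsis : ∀ {i i'} (_ : i = i'),
      N ((c.lam i).map f.continuous) = N ((c.lam i').map f.continuous) := by rintro i _ rfl; rfl
  have hloop : ∀ i, N ((D.loop i).map f.continuous) =
      N ((D.loop (D.sister i)).map f.continuous) := fun i => N.map_congr fun t => hf i t
  have htail : ∀ i u {P P'} (h : D.curve i u = P) (h' : D.curve (D.sister i) u = P'),
      N ((D.tail i u h).map f.continuous) = N ((D.tail (D.sister i) u h').map f.continuous) :=
    fun i u _ _ _ _ => N.map_congr fun t => hf i _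
  have hsymm : ∀ {y z : S} (p : Path y z),
      N (p.symm.map f.continuous) = (N (p.map f.continuous))⁻¹ := (N.comap f).map_symm
  rcases hr with ((⟨i, rfl⟩ | ⟨P, rfl⟩) | ⟨i, rfl⟩) | ⟨w, hw, rfl⟩
  · rw [dualLoopRelator, map_mul, c.lift_genImage_a hf N hN, c.lift_genImage_a hf N hN,
      hsis (D.sister_sister i)]
    group
  · simp only [triplePointRelator, map_mul, map_inv, c.lift_genImage_a hf N hN,
      lift_genImage_surfaceWord, ← hN, tLoop, Path.map_trans, N.map_trans, hsymm]
    rw [htail _ _ _ (c.labelling P).hα', htail _ _ _ (c.labelling P).hβ',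
      htail _ _ _ (c.labelling P).hγ']
    group
  · simp only [doubleCurveRelator, map_mul, map_inv, c.lift_genImage_a hf N hN,
      lift_genImage_surfaceWord, ← hN, curveLoop, Path.map_trans, N.map_trans, hsymm]
    rw [hloop i]
    group
  · rw [lift_genImage_inl]
    have : w ∈ (FreeGroup.lift c.s).ker := by
      rw [← c.normalClosure_surfaceRel]
      exact Subgroup.subset_normalClosure hw
    rw [MonoidHom.mem_ker.1 this, map_one]

end Choices

theorem Choices.presents_of_isQuotientMap [T2Space S] [PathConnectedSpace S] {X : Type*}
    [TopologicalSpace X] {f : C(S, X)} (hq : Topology.IsQuotientMap f)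
    (hrel : ∀ {y y'}, f y = f y' ↔ D.related y y')
    (hf : ∀ i t, f (D.curve i t) = f (D.curve (D.sister i) t)) : c.Presents f hf := by
  have hfin : ∀ P, (f ⁻¹' {P}).Finite := fun P => by
    obtain ⟨y, rfl⟩ := hq.surjective P
    refine (D.finite_setOf_related y).subset fun z hz => ?_
    exact hrel.1 (show f y = f z from Eq.symm hz)
  have hloc := exists_localContraction hq hrel hfin
  have : PathConnectedSpace X := hq.surjective.pathConnectedSpace f.continuous
  obtain ⟨N, hN⟩ := PathRep.exists_canonical (f x)
  obtain ⟨N₀, hN₀⟩ := PathRep.exists_canonical x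
  obtain ⟨φ, hφ, hφp⟩ := c.exists_surfaceHom
  let W := N₀.mapHom φ
  have hW : ∀ p : Path x x, c.mkGroup (c.surfaceWord p) = W p := fun p => by
    rw [← hφp, ← hN₀]
    rfl
  let a (i : Fin (2 * k)) : c.group := c.mkGroup (Choices.a i)
  obtain ⟨j, hjx, hjarc, hja⟩ := D.exists_gauge W c.lam c.labelling a
    (fun i => by
      rw [← map_mul]
      exact c.mkGroup_eq_one (.inl (.inl (.inl ⟨i, rfl⟩))))
    (fun i => by
      have h := c.mkGroup_eq_one (.inl (.inr ⟨i, rfl⟩))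
      simp only [Choices.doubleCurveRelator, map_mul, map_inv, hW, Choices.curveLoop,
        W.map_trans, W.map_symm] at h
      exact mul_inv_eq_one.1 h)
    (fun P => by
      have h := c.mkGroup_eq_one (.inl (.inl (.inr ⟨P, rfl⟩)))
      simpa only [Choices.triplePointRelator, map_mul, map_inv, hW, Choices.tLoop, W.map_trans,
        W.map_symm] using h)
  obtain ⟨V, hV⟩ := exists_descent hq.surjective hrel hfin hloc (W.gauge j) hjarc
  have hVx : ∀ p : Path x x, V (p.map f.continuous) = W p := fun p => by simp [hV, hjx]
  let e : c.group →* Pi1 X (f x) :=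
    PresentedGroup.toGroup (f := c.genImage f hf) fun r hr => c.lift_genImage_relators hf N hN hr
  have he : ∀ w, e (c.mkGroup w) = FreeGroup.lift (c.genImage f hf) w := fun w => rfl
  let m := V.toPi1 (f x)
  have hme : m.comp e = MonoidHom.id _ := by
    refine PresentedGroup.ext fun s => ?_
    rcases s with i | i
    · change m (e (PresentedGroup.of (Sum.inl i))) = PresentedGroup.of (Sum.inl i)
      have h1 : e (PresentedGroup.of (Sum.inl i)) = Pi1.map f x (c.s i) := by
        simp [e, Choices.genImage]
      obtain ⟨p, hp⟩ := Pi1.ofPath_surjective (c.s i)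
      rw [h1, ← hp, Pi1.map_ofPath]
      change V _ = _
      rw [hVx, ← hW, ← hφp, hp]
      simpa only [FreeGroup.lift_apply_of, FreeGroup.map.of] using! hφ (FreeGroup.of i)
    · change m (e (PresentedGroup.of (Sum.inr i))) = PresentedGroup.of (Sum.inr i)
      have h1 : e (PresentedGroup.of (Sum.inr i)) = Pi1.ofPath (c.dualLoop f hf i) := by
        simp [e, Choices.genImage]
      rw [h1]
      change V _ = a i
      rw [Choices.dualLoop, V.map_trans, V.map_cast, V.map_symm, hV, hV, hja]
  have hinj : Function.Injective e := fun u v huv => by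
    simpa [← MonoidHom.comp_apply, hme] using congrArg m huv
  have hsurj : Function.Surjective e := by
    obtain ⟨h, hx1, hgauge⟩ := PathRep.exists_gauge_of_eq_on_loops ((W.gauge j).mapHom e)
      (N.comap f) (x := x) fun p => by
        have : (W.gauge j) p = c.mkGroup (c.surfaceWord p) := by simp [hjx, hW]
        rw [PathRep.mapHom_apply, PathRep.comap_apply, this, he, c.lift_genImage_surfaceWord, hN]
    simp only [PathRep.mapHom_apply, PathRep.comap_apply] at hgauge
    have hlam : ∀ i, h (D.curve i 0) = h (D.curve (D.sister i) 0) := fun i => by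
      have h1 : e (a i) = _ := c.lift_genImage_a hf N hN i
      rw [← hja, map_mul, map_inv, hgauge, hgauge, hx1] at h1
      simp only [one_mul, mul_assoc, mul_inv_rev, inv_inv, mul_right_inj] at h1
      rwa [← mul_assoc, mul_eq_right, inv_mul_eq_one] at h1
    have hcurve : ∀ i t, h (D.curve i t) = h (D.curve (D.sister i) t) := fun i t => by
      have h1 := congrArg e (hjarc i 0 t)
      have h2 : N ((D.arc i 0 t).map f.continuous) =
        N ((D.arc (D.sister i) 0 t).map f.continuous) := N.map_congr fun r => hf i _
      rw [hgauge, hgauge, hlam i, h2] at h1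
      simpa using h1
    have hh : ∀ {y z}, f y = f z → h y = h z := fun {y z} hyz => by
      refine ((D.mem_iff_of_related (A := {w | h y = h w}) (fun i t ht => ?_) (hrel.1 hyz)).1 rfl)
      exact Eq.trans ht (hcurve i t)
    choose b hb using hq.surjective
    intro d
    obtain ⟨p, rfl⟩ := Pi1.ofPath_surjective d
    have key := pathRep_mem_of_map_mem hq hrel (fun P => ⟨(hloc P univ Filter.univ_mem).choose⟩)
      (N.gauge (h ∘ b)) e.range (fun {y z} p => by
        refine ⟨W.gauge j p, ?_⟩
        rw [hgauge, PathRep.gauge_apply, Function.comp_apply, Function.comp_apply, hh (hb (f y)),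
          hh (hb (f z))]) p
    simpa [hh (hb (f x)), hx1, hN] using key
  refine ⟨MulEquiv.ofBijective e ⟨hinj, hsurj⟩, fun i => ?_, fun i => ?_⟩
  · simp [e, Choices.genImage]
  · simp [e, Choices.genImage]

end JohanssonDiagram

end

theorem mainTheorem4 {S : Type u} [TopologicalSpace S] [T2Space S] [CompactSpace S]
    [ConnectedSpace S] [ChartedSpace (EuclideanSpace ℝ (Fin 2)) S] [IsManifold (𝓡 2) ∞ S]
    (hS : IsOrientable 2 S) (g : ℕ) (hg : HasGenus S g)
    (k : ℕ) (D : JohanssonDiagram S k)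
    (x : S) (hx : ∀ i t, D.curve i t ≠ x) (c : D.Choices g x) :
    -- the pseudo Dehn `g`-torus defined by the diagram
    c.Presents D.proj D.proj_curve ∧
    -- every Dehn `g`-torus in a closed orientable 3-manifold with this Johansson diagram
    ∀ (M : Type v) [TopologicalSpace M] [T2Space M] [CompactSpace M] [ConnectedSpace M]
      [ChartedSpace (EuclideanSpace ℝ (Fin 3)) M] [IsManifold (𝓡 3) ∞ M]
      (_ : IsOrientable 3 M) (f : S → M) (hf : IsGeneralPositionImmersion f)
      (hD : D.IsDiagramOf f), c.Presents hf.toRange (hD.toRange_curve hf) := by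
  have : LocallyPathConnectedSpace S :=
    ChartedSpace.locallyPathConnectedSpace (EuclideanSpace ℝ (Fin 2)) S
  have : PathConnectedSpace S := pathConnectedSpace_iff_connectedSpace.2 inferInstance
  refine ⟨c.presents_of_isQuotientMap isQuotientMap_quotient_mk' Quotient.eq _, ?_⟩
  intro M _ _ _ _ _ _ _ f hf hD
  refine c.presents_of_isQuotientMap ?_ (Subtype.ext_iff.trans (hD _ _)) _
  exact hf.toRange.continuous.isClosedMap.isQuotientMap hf.toRange.continuous
    rangeFactorization_surjective
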